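/- Let $d\ge 1$. For a finite nonempty set $A\subseteq\mathbb{R}^d$ put $\delta_A=\frac{1}{\#A}\sum_{a\in A}\delta_a$, where $\delta_a$ is the Dirac measure at $a$. A pair $(R,B)$, where $R$ is a $d\times d$ integer matrix all of whose (complex) eigenvalues have modulus $>1$ and $B\subseteq\mathbb{Z}^d$ is finite, is called admissible if there is a finite set $L\subseteq\mathbb{Z}^d$ with $\#L=\#B$ such that the matrix $\big[\tfrac{1}{\sqrt{\#B}}\,e^{-2\pi i (R^{-1}b)\cdot \ell}\big]_{b\in B,\ \ell\in L}$ is unitary. Let $\mathcal{D}_d$ be the set of all pairs $(R,B)$ with $R=\mathrm{diag}(m_1,\dots,m_d)$, where $m_1,\dots,m_d\ge 2$ are integers, and $B$ a nonempty subset of $\{0,1,\dots,m_1-1\}\times\cdots\times\{0,1,\dots,m_d-1\}$. Theorem. Let $\{(R_n,B_n)\}_{n=1}^\infty\subseteq\mathcal{D}_d$ be a sequence of admissible pairs. Suppose that there is an admissible pair $(R,B)$ such that $(R_n,B_n)=(R,B)$ for infinitely many $n$ and all diagonal entries of $R$ are at least $d+1$. Then the measures $$\mu_n=\delta_{R_1^{-1}B_1}*\delta_{(R_2R_1)^{-1}B_2}*\cdots*\delta_{(R_n\cdots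 R_2R_1)^{-1}B_n}$$ converge weakly to a Borel probability measure $\mu$ on $\mathbb{R}^d$ (the infinite convolution of the sequence), and $\mu$ is a spectral measure with a spectrum in $\mathbb{Z}^d$: there is a (countable) set $\Lambda\subseteq\mathbb{Z}^d$ such that the exponentials $e_\lambda(x)=e^{2\pi i\lambda\cdot x}$, $\lambda\in\Lambda$, form an orthonormal basis of $L^2(\mu)$. -/

import Mathlib

open MeasureTheory Filter Topology
open scoped ENNReal BoundedContinuousFunction

noncomputable section

namespace InfConv

/-- The integer vector `k ∈ ℤ^d`, regarded as a point of Euclidean space `ℝ^d`. -/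
def intVec {d : ℕ} (k : Fin d → ℤ) : EuclideanSpace ℝ (Fin d) :=
  WithLp.toLp 2 (fun i => (k i : ℝ))

/-- The integer lattice `ℤ^d ⊆ ℝ^d`. -/
def intLattice (d : ℕ) : Set (EuclideanSpace ℝ (Fin d)) :=
  Set.range intVec

/-- The point `M⁻¹ b ∈ ℝ^d`, for an integer matrix `M` (inverted over `ℝ`) and `b ∈ ℤ^d`. -/
def invApply {d : ℕ} (M : Matrix (Fin d) (Fin d) ℤ) (b : Fin d → ℤ) :
    EuclideanSpace ℝ (Fin d) :=
  WithLp.toLp 2 (Matrix.mulVec (M.map (Int.cast : ℤ → ℝ))⁻¹ (fun i => (b i : ℝ)))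

open Classical in
/-- The finite set `M⁻¹ B ⊆ ℝ^d`. -/
def invImage {d : ℕ} (M : Matrix (Fin d) (Fin d) ℤ) (B : Finset (Fin d → ℤ)) :
    Finset (EuclideanSpace ℝ (Fin d)) :=
  B.image (invApply M)

/-- The uniform discrete measure `δ_A = (1 / #A) ∑_{a ∈ A} δ_a`. -/
def discreteMeasure {d : ℕ} (A : Finset (EuclideanSpace ℝ (Fin d))) :
    Measure (EuclideanSpace ℝ (Fin d)) :=
  (A.card : ℝ≥0∞)⁻¹ • ∑ a ∈ A, Measure.dirac a

/-- All complex eigenvalues of the integer matrix `R` have modulus strictly greater than `1`. -/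
def IsExpanding {d : ℕ} (R : Matrix (Fin d) (Fin d) ℤ) : Prop :=
  ∀ z : ℂ, Module.End.HasEigenvalue (Matrix.toLin' (R.map (Int.cast : ℤ → ℂ))) z → 1 < ‖z‖

/-- The matrix `[ (#B)^{-1/2} e^{-2πi (R⁻¹ b) ⬝ ℓ} ]` with rows `b ∈ B` and columns `ℓ ∈ L`. -/
def hadamardMatrix {d : ℕ} (R : Matrix (Fin d) (Fin d) ℤ) (B L : Finset (Fin d → ℤ)) :
    Matrix B L ℂ :=
  Matrix.of fun b l =>
    ((1 / Real.sqrt (B.card : ℝ) : ℝ) : ℂ) *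
      Complex.exp (-2 * Real.pi * Complex.I *
        ((inner ℝ (invApply R b.1) (intVec l.1) : ℝ) : ℂ))

/-- `(R, B)` is an admissible pair: `R` is expanding and there is a finite `L ⊆ ℤ^d` with
`#L = #B` for which the matrix `hadamardMatrix R B L` is unitary. -/
def IsAdmissiblePair {d : ℕ} (R : Matrix (Fin d) (Fin d) ℤ) (B : Finset (Fin d → ℤ)) : Prop :=
  IsExpanding R ∧
    ∃ L : Finset (Fin d → ℤ), L.card = B.card ∧
      hadamardMatrix R B L * (hadamardMatrix R B L).conjTranspose = 1 ∧
      (hadamardMatrix R B L).conjTranspose * hadamardMatrix R B L = 1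

/-- The class `𝒟_d` of pairs `(R, B)` with `R = diag(m_1, …, m_d)`, all `m_i ≥ 2` integers, and
`B` a nonempty subset of `{0, …, m_1 - 1} × ⋯ × {0, …, m_d - 1}`. -/
def diagonalPairs (d : ℕ) : Set (Matrix (Fin d) (Fin d) ℤ × Finset (Fin d → ℤ)) :=
  {p | p.1.IsDiag ∧ (∀ i, 2 ≤ p.1 i i) ∧ p.2.Nonempty ∧
    ∀ b ∈ p.2, ∀ i, 0 ≤ b i ∧ b i ≤ p.1 i i - 1}

/-- The product of the first `n` matrices, the later ones on the left. Sequences are indexed from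
`0`, so that this is `R_n ⋯ R_2 R_1` in the usual numbering `R_{k+1} = R k`. -/
def matProd {d : ℕ} (R : ℕ → Matrix (Fin d) (Fin d) ℤ) : ℕ → Matrix (Fin d) (Fin d) ℤ
  | 0 => 1
  | n + 1 => R n * matProd R n

/-- The finite convolution
`μ_n = δ_{R_1⁻¹ B_1} ∗ δ_{(R_2 R_1)⁻¹ B_2} ∗ ⋯ ∗ δ_{(R_n ⋯ R_1)⁻¹ B_n}`
(and `μ_0 = δ_0`, the neutral element of convolution). -/
def finiteConvolution {d : ℕ} (R : ℕ → Matrix (Fin d) (Fin d) ℤ)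
    (B : ℕ → Finset (Fin d → ℤ)) : ℕ → Measure (EuclideanSpace ℝ (Fin d))
  | 0 => Measure.dirac 0
  | n + 1 =>
      Measure.conv (finiteConvolution R B n)
        (discreteMeasure (invImage (matProd R (n + 1)) (B n)))

/-- The Borel probability measure `μ` is the infinite convolution of the sequence `(R_n, B_n)`,
i.e. the weak limit of the finite convolutions `μ_n`. -/
def IsInfiniteConvolution {d : ℕ} (R : ℕ → Matrix (Fin d) (Fin d) ℤ)
    (B : ℕ → Finset (Fin d → ℤ)) (μ : Measure (EuclideanSpace ℝ (Fin d))) : Prop :=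
  IsProbabilityMeasure μ ∧
    ∀ f : EuclideanSpace ℝ (Fin d) →ᵇ ℝ,
      Tendsto (fun n => ∫ x, f x ∂(finiteConvolution R B n)) atTop (𝓝 (∫ x, f x ∂μ))

/-- The exponential function `e_ξ(x) = e^{2πi ξ ⬝ x}`. -/
def expFun {d : ℕ} (ξ x : EuclideanSpace ℝ (Fin d)) : ℂ :=
  Complex.exp (2 * Real.pi * Complex.I * ((inner ℝ ξ x : ℝ) : ℂ))

/-- The countable set `Λ ⊆ ℝ^d` is a spectrum of `μ`: the exponentials `e_ξ`, `ξ ∈ Λ`, form an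
orthonormal (Hilbert) basis of `L²(μ)`. -/
def IsSpectrum {d : ℕ} (μ : Measure (EuclideanSpace ℝ (Fin d)))
    (Λ : Set (EuclideanSpace ℝ (Fin d))) : Prop :=
  Λ.Countable ∧
    ∃ e : HilbertBasis Λ ℂ (Lp ℂ 2 μ), ∀ ξ : Λ, (e ξ : EuclideanSpace ℝ (Fin d) → ℂ) =ᵐ[μ] expFun ξ.1

end InfConv

end

/-!
Write `P_n = R_n ⋯ R_1` and let `ν_n` be the infinite convolution of the sequence shifted by `n`,
so that the transform of `μ` at `ξ` is a trigonometric polynomial, the `n`-th mask product, times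
the transform of `ν_n` at `P_n⁻¹ ξ`. Unitarity of the Hadamard matrices provides finite spectra for
the finite convolutions; they extend one another, and each new frequency may be moved freely by
`P_n ℤ^d`. If infinitely many `ν_n` have transforms bounded below, near every point, at some integer
translate of that point (equi-positivity), these moves keep the terms of the finite Parseval sums
comparable with `‖μ̂(ξ + λ)‖²`; Tannery's theorem then yields `∑ ‖μ̂(ξ + λ)‖² = 1` for all `ξ`,
which by the criterion of Jorgensen and Pedersen makes the union of the finite spectra a spectrum.

Since the probability measures on the unit cube form a compact space, equi-positivity follows once
no transform of `δ_{R⁻¹B} * (R⁻¹ν)`, with `ν` carried by the cube, vanishes on a whole coset of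
`ℤ^d`. If one did, then by Stone–Weierstrass on the torus every support point would have another
support point in its coset. Following such points through the digits produces a sequence of integer
vectors with a carry, in one of the `d` coordinates, at every step; but carries in coordinate `i`
are at least `m_i > d` steps apart, which is impossible.
-/

noncomputable section

namespace InfConv

open scoped ComplexConjugate

variable {d : ℕ}

local notation "𝔼" n:max => EuclideanSpace ℝ (Fin n)

section Completeness

open scoped RealInnerProductSpace

variable {V : Type*} [NormedAddCommGroup V] [InnerProductSpace ℝ V] [MeasurableSpace V]
  {μ : Measure V}

lemma charFun_withDensity_ofReal {u : V → ℝ} (hu : AEMeasurable u μ) (t : V) :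
    charFun (μ.withDensity fun x => ENNReal.ofReal (u x)) t =
      ∫ x, (max (u x) 0 : ℝ) * Complex.exp (⟪x, t⟫ * Complex.I) ∂μ := by
  rw [charFun_apply]
  refine (integral_withDensity_eq_integral_smul₀ hu.real_toNNReal _).trans ?_
  simp [NNReal.smul_def]

variable [SecondCountableTopology V] [BorelSpace V]

lemma integrable_mul_exp_inner {f : V → ℂ} (hf : Integrable f μ) (t : V) :
    Integrable (fun x => f x * Complex.exp (⟪x, t⟫ * Complex.I)) μ :=
  hf.mul_bdd (c := 1) (by fun_prop) (.of_forall fun x => (Complex.norm_exp_ofReal_mul_I _).le)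

variable [CompleteSpace V]

lemma ae_eq_zero_of_integral_ofReal_mul_exp_inner_eq_zero {u : V → ℝ} (hu : Integrable u μ)
    (h : ∀ t, ∫ x, (u x : ℂ) * Complex.exp (⟪x, t⟫ * Complex.I) ∂μ = 0) : u =ᵐ[μ] 0 := by
  have : IsFiniteMeasure (μ.withDensity fun x => ENNReal.ofReal (u x)) :=
    isFiniteMeasure_withDensity_ofReal hu.2
  have : IsFiniteMeasure (μ.withDensity fun x => ENNReal.ofReal ((-u) x)) :=
    isFiniteMeasure_withDensity_ofReal hu.neg.2
  have hparts : (μ.withDensity fun x => ENNReal.ofReal (u x)) =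
      μ.withDensity fun x => ENNReal.ofReal ((-u) x) := by
    refine Measure.ext_of_charFun (funext fun t => ?_)
    have hint {w : V → ℝ} (hw : Integrable w μ) :
        Integrable (fun x => (max (w x) 0 : ℝ) * Complex.exp (⟪x, t⟫ * Complex.I)) μ :=
      integrable_mul_exp_inner hw.pos_part.ofReal t
    rw [charFun_withDensity_ofReal hu.aemeasurable, charFun_withDensity_ofReal hu.aemeasurable.neg,
      ← sub_eq_zero, ← integral_sub (hint hu) (hint hu.neg), ← h t]
    refine integral_congr_ae (.of_forall fun x => ?_)
    simp only [← sub_mul, ← Complex.ofReal_sub, Pi.neg_apply, max_zero_sub_max_neg_zero_eq_self]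
  rw [withDensity_eq_iff hu.aemeasurable.ennreal_ofReal hu.aemeasurable.neg.ennreal_ofReal
    hu.lintegral_lt_top.ne] at hparts
  filter_upwards [hparts] with x hx
  have hmax := congrArg ENNReal.toReal hx
  simp only [ENNReal.toReal_ofReal', Pi.neg_apply] at hmax
  rw [← max_zero_sub_max_neg_zero_eq_self (u x), hmax, sub_self, Pi.zero_apply]

lemma ae_eq_zero_of_integral_mul_exp_inner_eq_zero {f : V → ℂ} (hf : Integrable f μ)
    (h : ∀ t, ∫ x, f x * Complex.exp (⟪x, t⟫ * Complex.I) ∂μ = 0) : f =ᵐ[μ] 0 := by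
  have hconj : ∀ t, ∫ x, conj (f x) * Complex.exp (⟪x, t⟫ * Complex.I) ∂μ = 0 := fun t => by
    rw [← map_zero conj, ← h (-t), ← integral_conj]
    simp [← Complex.exp_conj]
  have hfc : Integrable (fun x => conj (f x)) μ := Complex.conjLIE.integrable_comp_iff.2 hf
  have hre : (fun x => (f x).re) =ᵐ[μ] 0 := by
    refine ae_eq_zero_of_integral_ofReal_mul_exp_inner_eq_zero hf.re fun t => ?_
    simp only [Complex.re_eq_add_conj, div_mul_eq_mul_div, add_mul]
    rw [integral_div, integral_add (integrable_mul_exp_inner hf t)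
      (integrable_mul_exp_inner hfc t), h, hconj, add_zero, zero_div]
  have him : (fun x => (f x).im) =ᵐ[μ] 0 := by
    refine ae_eq_zero_of_integral_ofReal_mul_exp_inner_eq_zero hf.im fun t => ?_
    simp only [Complex.im_eq_sub_conj, div_mul_eq_mul_div, sub_mul]
    rw [integral_div, integral_sub (integrable_mul_exp_inner hf t)
      (integrable_mul_exp_inner hfc t), h, hconj, sub_zero, zero_div]
  filter_upwards [hre, him] with x hx_re hx_im
  exact Complex.ext hx_re hx_im

end Completeness

section Parseval

variable {𝕜 H ι : Type*} [RCLike 𝕜] [NormedAddCommGroup H] [InnerProductSpace 𝕜 H]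

lemma norm_le_norm_sub_of_hasSum {v : ι → H} (hv : Orthonormal 𝕜 v) {x f : H}
    (hx : HasSum (fun i => ‖inner 𝕜 (v i) x‖ ^ 2) (‖x‖ ^ 2)) (hf : ∀ i, inner 𝕜 (v i) f = 0) :
    ‖x‖ ≤ ‖x - f‖ := by
  have hbessel := hv.tsum_inner_products_le (x - f)
  simp only [inner_sub_right, hf, sub_zero, hx.tsum_eq] at hbessel
  exact le_of_sq_le_sq hbessel (norm_nonneg _)

lemma inner_eq_zero_of_hasSum_sq {v : ι → H} (hv : Orthonormal 𝕜 v) {x f : H}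
    (hx : HasSum (fun i => ‖inner 𝕜 (v i) x‖ ^ 2) (‖x‖ ^ 2)) (hf : ∀ i, inner 𝕜 (v i) f = 0) :
    inner 𝕜 f x = 0 := by
  have horth : ∀ i, inner 𝕜 (v i) ((𝕜 ∙ f).starProjection x) = 0 := fun i => by
    rw [Submodule.starProjection_singleton, inner_smul_right, hf, mul_zero]
  have hle := norm_le_norm_sub_of_hasSum hv hx horth
  have hpyth := Submodule.norm_sq_eq_add_norm_sq_starProjection x (𝕜 ∙ f)
  rw [Submodule.starProjection_orthogonal_val] at hpyth
  have hproj : (𝕜 ∙ f).starProjection x = 0 := by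
    rw [← norm_eq_zero]
    nlinarith [norm_nonneg x, norm_nonneg ((𝕜 ∙ f).starProjection x)]
  rw [Submodule.starProjection_apply_eq_zero_iff] at hproj
  exact Submodule.mem_orthogonal_singleton_iff_inner_right.1 hproj

lemma eq_zero_of_hasSum_of_ne {f : ι → ℝ} {a : ℝ} (hf : ∀ i, 0 ≤ f i) (h : HasSum f a) {i j : ι}
    (hi : f i = a) (hij : j ≠ i) : f j = 0 := by
  classical
  have := sum_le_hasSum {i, j} (fun k _ => hf k) h
  rw [Finset.sum_pair hij.symm] at this
  linarith [hf j]

end Parseval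

@[simp] lemma intVec_apply (k : Fin d → ℤ) (i : Fin d) : intVec k i = (k i : ℝ) := rfl

lemma intVec_injective : Function.Injective (intVec (d := d)) := fun k l h =>
  funext fun i => by simpa using congrArg (fun x : 𝔼 d => x i) h

@[simp] lemma intVec_zero : intVec (0 : Fin d → ℤ) = 0 := by ext i; simp

lemma intVec_add (k l : Fin d → ℤ) : intVec (k + l) = intVec k + intVec l := by ext i; simp

lemma intVec_sub (k l : Fin d → ℤ) : intVec (k - l) = intVec k - intVec l := by ext i; simp

lemma inner_eq_sum (ξ x : 𝔼 d) : inner ℝ ξ x = ∑ i, ξ i * x i := by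
  simp [PiLp.inner_apply, mul_comm]

lemma expFun_eq_exp_ofReal_mul_I (ξ x : 𝔼 d) :
    expFun ξ x = Complex.exp ((2 * Real.pi * inner ℝ ξ x : ℝ) * Complex.I) := by
  rw [expFun]; push_cast; ring_nf

lemma expFun_comm (ξ x : 𝔼 d) : expFun ξ x = expFun x ξ := by
  rw [expFun, expFun, real_inner_comm]

lemma expFun_add_left (ξ η x : 𝔼 d) : expFun (ξ + η) x = expFun ξ x * expFun η x := by
  simp only [expFun, inner_add_left, Complex.ofReal_add, mul_add, Complex.exp_add]

lemma expFun_add_right (ξ x y : 𝔼 d) : expFun ξ (x + y) = expFun ξ x * expFun ξ y := by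
  rw [expFun_comm, expFun_add_left, expFun_comm x, expFun_comm y]

@[simp] lemma expFun_zero_left (x : 𝔼 d) : expFun 0 x = 1 := by simp [expFun]

@[simp] lemma expFun_zero_right (ξ : 𝔼 d) : expFun ξ 0 = 1 := by simp [expFun]

@[simp] lemma norm_expFun (ξ x : 𝔼 d) : ‖expFun ξ x‖ = 1 := by
  rw [expFun_eq_exp_ofReal_mul_I, Complex.norm_exp_ofReal_mul_I]

lemma expFun_neg_left (ξ x : 𝔼 d) : expFun (-ξ) x = conj (expFun ξ x) := by
  simp [expFun_eq_exp_ofReal_mul_I, ← Complex.exp_conj, map_ofNat]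

@[simp] lemma expFun_intVec (k l : Fin d → ℤ) : expFun (intVec k) (intVec l) = 1 := by
  rw [expFun, Complex.exp_eq_one_iff]
  refine ⟨∑ i, k i * l i, ?_⟩
  rw [inner_eq_sum]
  push_cast [intVec_apply]
  ring

lemma continuous_expFun (ξ : 𝔼 d) : Continuous (expFun ξ) := by
  unfold expFun; fun_prop

lemma norm_expFun_sub_le (ξ η x : 𝔼 d) :
    ‖expFun ξ x - expFun η x‖ ≤ 2 * Real.pi * (‖ξ - η‖ * ‖x‖) := by
  have hfactor : expFun ξ x - expFun η x = expFun η x * (expFun (ξ - η) x - 1) := by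
    rw [mul_sub, ← expFun_add_left, add_sub_cancel, mul_one]
  rw [hfactor, norm_mul, norm_expFun, one_mul, expFun_eq_exp_ofReal_mul_I, mul_comm _ Complex.I]
  refine Real.norm_exp_I_mul_ofReal_sub_one_le.trans ?_
  rw [Real.norm_eq_abs, abs_mul, abs_of_pos Real.two_pi_pos]
  gcongr
  exact abs_real_inner_le_norm _ _

section FourierTransform

variable {μ : Measure (𝔼 d)}

/-- The Fourier transform of a measure, with the sign and normalization of `expFun`. -/
def fourierTransform (μ : Measure (𝔼 d)) (ξ : 𝔼 d) : ℂ := ∫ x, expFun ξ x ∂μ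

lemma fourierTransform_eq_charFun (μ : Measure (𝔼 d)) (ξ : 𝔼 d) :
    fourierTransform μ ξ = charFun μ ((2 * Real.pi) • ξ) := by
  simp only [fourierTransform, charFun_apply, expFun_eq_exp_ofReal_mul_I, inner_smul_right,
    real_inner_comm]

lemma charFun_eq_fourierTransform (μ : Measure (𝔼 d)) (t : 𝔼 d) :
    charFun μ t = fourierTransform μ ((2 * Real.pi)⁻¹ • t) := by
  rw [fourierTransform_eq_charFun, smul_smul, mul_inv_cancel₀ Real.two_pi_pos.ne', one_smul]

lemma integrable_expFun [IsFiniteMeasure μ] (ξ : 𝔼 d) : Integrable (expFun ξ) μ :=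
  .of_bound (continuous_expFun ξ).aestronglyMeasurable 1 (by simp)

lemma norm_fourierTransform_le_one [IsProbabilityMeasure μ] (ξ : 𝔼 d) :
    ‖fourierTransform μ ξ‖ ≤ 1 := by
  rw [fourierTransform_eq_charFun]
  exact norm_charFun_le_one _

@[simp] lemma fourierTransform_zero [IsProbabilityMeasure μ] : fourierTransform μ 0 = 1 := by
  simp [fourierTransform]

lemma norm_fourierTransform_neg (ξ : 𝔼 d) :
    ‖fourierTransform μ (-ξ)‖ = ‖fourierTransform μ ξ‖ := by
  rw [fourierTransform_eq_charFun, smul_neg, charFun_neg, RCLike.norm_conj,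
    fourierTransform_eq_charFun]

lemma norm_fourierTransform_sub_le [IsProbabilityMeasure μ] {C : ℝ} (hC : ∀ᵐ x ∂μ, ‖x‖ ≤ C)
    (ξ η : 𝔼 d) :
    ‖fourierTransform μ ξ - fourierTransform μ η‖ ≤ 2 * Real.pi * C * ‖ξ - η‖ := by
  rw [fourierTransform, fourierTransform,
    ← integral_sub (integrable_expFun ξ) (integrable_expFun η)]
  have hbound : ∀ᵐ x ∂μ, ‖expFun ξ x - expFun η x‖ ≤ 2 * Real.pi * C * ‖ξ - η‖ := by
    filter_upwards [hC] with x hx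
    refine (norm_expFun_sub_le ξ η x).trans ?_
    rw [mul_assoc _ C, mul_comm C]
    gcongr
  simpa using norm_integral_le_of_norm_le_const hbound

variable [IsFiniteMeasure μ]

lemma memLp_expFun (ξ : 𝔼 d) : MemLp (expFun ξ) 2 μ :=
  MemLp.of_bound (continuous_expFun ξ).aestronglyMeasurable 1 (by simp)

variable (μ) in
/-- The exponential `e_ξ` as an element of `L²(μ)`. -/
def expLp (ξ : 𝔼 d) : Lp ℂ 2 μ := (memLp_expFun ξ).toLp _

lemma coeFn_expLp (ξ : 𝔼 d) : expLp μ ξ =ᵐ[μ] expFun ξ := MemLp.coeFn_toLp _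

lemma inner_expLp_left (ξ : 𝔼 d) (f : Lp ℂ 2 μ) :
    inner ℂ (expLp μ ξ) f = ∫ x, f x * expFun (-ξ) x ∂μ := by
  rw [L2.inner_def]
  refine integral_congr_ae ?_
  filter_upwards [coeFn_expLp ξ] with x hx
  rw [hx, expFun_neg_left, RCLike.inner_apply]

lemma inner_expLp (ξ η : 𝔼 d) :
    inner ℂ (expLp μ ξ) (expLp μ η) = fourierTransform μ (η - ξ) := by
  rw [inner_expLp_left, fourierTransform]
  refine integral_congr_ae ?_
  filter_upwards [coeFn_expLp η] with x hx
  rw [hx, sub_eq_add_neg, expFun_add_left]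

lemma eq_zero_of_inner_expLp_eq_zero {f : Lp ℂ 2 μ} (hf : ∀ ξ, inner ℂ (expLp μ ξ) f = 0) :
    f = 0 := by
  rw [Lp.eq_zero_iff_ae_eq_zero]
  refine ae_eq_zero_of_integral_mul_exp_inner_eq_zero ((Lp.memLp f).integrable one_le_two)
    fun t => ?_
  rw [← hf (-((2 * Real.pi)⁻¹ • t)), inner_expLp_left, neg_neg]
  refine integral_congr_ae (.of_forall fun x => ?_)
  beta_reduce
  rw [expFun_eq_exp_ofReal_mul_I, real_inner_smul_left,
    mul_inv_cancel_left₀ Real.two_pi_pos.ne', real_inner_comm]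

end FourierTransform

section Spectrum

variable {μ : Measure (𝔼 d)} [IsProbabilityMeasure μ] {S : Set (𝔼 d)}

lemma orthonormal_expLp_of_hasSum
    (hsum : ∀ ξ, HasSum (fun a : S => ‖fourierTransform μ (ξ + a)‖ ^ 2) 1) :
    Orthonormal ℂ fun a : S => expLp μ a := by
  classical
  rw [orthonormal_iff_ite]
  intro a b
  rw [inner_expLp]
  split_ifs with hab
  · simp [hab]
  · have := eq_zero_of_hasSum_of_ne (fun _ => sq_nonneg _) (hsum (-a)) (i := a) (by simp)
      (Ne.symm hab)
    rwa [sq_eq_zero_iff, norm_eq_zero, neg_add_eq_sub] at this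

/-- The Jorgensen–Pedersen criterion. -/
theorem isSpectrum_of_hasSum (hS : S.Countable)
    (hsum : ∀ ξ, HasSum (fun a : S => ‖fourierTransform μ (ξ + a)‖ ^ 2) 1) : IsSpectrum μ S := by
  have hon := orthonormal_expLp_of_hasSum hsum
  have hparseval : ∀ ξ, HasSum (fun a : S => ‖inner ℂ (expLp μ a) (expLp μ ξ)‖ ^ 2)
      (‖expLp μ ξ‖ ^ 2) := fun ξ => by
    have hnorm : ‖expLp μ ξ‖ ^ 2 = 1 := by
      rw [@norm_sq_eq_re_inner ℂ, inner_expLp, sub_self, fourierTransform_zero, RCLike.one_re]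
    convert hsum (-ξ) using 3 with a
    rw [inner_expLp, ← norm_fourierTransform_neg, neg_sub, sub_eq_neg_add]
  have hcomplete : (Submodule.span ℂ (Set.range fun a : S => expLp μ a))ᗮ = ⊥ := by
    refine (Submodule.eq_bot_iff _).2 fun f hf => eq_zero_of_inner_expLp_eq_zero fun ξ => ?_
    refine inner_eq_zero_symm.1 (inner_eq_zero_of_hasSum_sq hon (hparseval ξ) fun a => ?_)
    exact (Submodule.mem_orthogonal _ _).1 hf _ (Submodule.subset_span ⟨a, rfl⟩)
  refine ⟨hS, HilbertBasis.mkOfOrthogonalEqBot hon hcomplete, fun ξ => ?_⟩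
  rw [HilbertBasis.coe_mkOfOrthogonalEqBot]
  exact coeFn_expLp _

end Spectrum

/-- Division of the coordinates by the integers `m i`. -/
def invScale (m : Fin d → ℤ) : 𝔼 d →L[ℝ] 𝔼 d :=
  Matrix.toEuclideanCLM (𝕜 := ℝ) (Matrix.diagonal fun i => (m i : ℝ)⁻¹)

@[simp] lemma invScale_apply (m : Fin d → ℤ) (x : 𝔼 d) (i : Fin d) :
    invScale m x i = x i / m i := by
  simp [invScale, Matrix.mulVec_diagonal, div_eq_inv_mul]

@[simp] lemma invScale_one (x : 𝔼 d) : invScale 1 x = x := by ext i; simp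

lemma invScale_invScale (m n : Fin d → ℤ) (x : 𝔼 d) :
    invScale m (invScale n x) = invScale (n * m) x := by
  ext i; simp [div_div]

lemma invScale_intVec_mul {m : Fin d → ℤ} (hm : ∀ i, m i ≠ 0) (k : Fin d → ℤ) :
    invScale m (intVec (m * k)) = intVec k := by
  ext i
  simp [hm i]

lemma inner_invScale_left (m : Fin d → ℤ) (ξ x : 𝔼 d) :
    inner ℝ (invScale m ξ) x = inner ℝ ξ (invScale m x) := by
  simp only [inner_eq_sum, invScale_apply, div_mul_eq_mul_div, mul_div_assoc]

lemma expFun_invScale_left (m : Fin d → ℤ) (ξ x : 𝔼 d) :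
    expFun (invScale m ξ) x = expFun ξ (invScale m x) := by
  rw [expFun, inner_invScale_left, expFun]

lemma invApply_diagonal {m : Fin d → ℤ} (hm : ∀ i, m i ≠ 0) (b : Fin d → ℤ) :
    invApply (Matrix.diagonal m) b = invScale m (intVec b) := by
  have hinv : ((Matrix.diagonal m).map (Int.cast : ℤ → ℝ))⁻¹ =
      Matrix.diagonal fun i => (m i : ℝ)⁻¹ :=
    Matrix.inv_eq_left_inv (by simp [Matrix.diagonal_map, hm])
  rw [invApply, hinv]
  rfl

section Products

variable {r : ℕ → Fin d → ℤ} {B : ℕ → Finset (Fin d → ℤ)}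

/-- The diagonal of the product of the first `n` diagonal matrices. -/
def diagProd (r : ℕ → Fin d → ℤ) (n : ℕ) : Fin d → ℤ := ∏ j ∈ Finset.range n, r j

@[simp] lemma diagProd_zero (r : ℕ → Fin d → ℤ) : diagProd r 0 = 1 := rfl

lemma diagProd_succ (r : ℕ → Fin d → ℤ) (n : ℕ) : diagProd r (n + 1) = diagProd r n * r n :=
  Finset.prod_range_succ _ _

lemma diagProd_add (r : ℕ → Fin d → ℤ) (n k : ℕ) :
    diagProd r (n + k) = diagProd r n * diagProd (fun j => r (n + j)) k :=
  Finset.prod_range_add _ _ _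

lemma diagProd_ne_zero (hr : ∀ n i, r n i ≠ 0) (n : ℕ) (i : Fin d) : diagProd r n i ≠ 0 := by
  rw [diagProd, Finset.prod_apply, Finset.prod_ne_zero_iff]
  exact fun j _ => hr j i

lemma two_pow_le_diagProd (hr : ∀ n i, 2 ≤ r n i) (n : ℕ) (i : Fin d) :
    2 ^ n ≤ diagProd r n i := by
  rw [diagProd, Finset.prod_apply]
  simpa using Finset.prod_le_prod (s := Finset.range n) (fun _ _ => zero_le_two) fun j _ => hr j i

lemma tendsto_invScale_diagProd (hr : ∀ n i, 2 ≤ r n i) (x : 𝔼 d) :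
    Tendsto (fun n => invScale (diagProd r n) x) atTop (𝓝 0) := by
  have hcoord : Tendsto (fun n => (invScale (diagProd r n) x).ofLp) atTop (𝓝 0) := by
    refine tendsto_pi_nhds.2 fun i => ?_
    simp only [invScale_apply, Pi.zero_apply]
    refine Tendsto.const_div_atTop (tendsto_atTop_mono (fun n => ?_)
      (tendsto_pow_atTop_atTop_of_one_lt (one_lt_two (α := ℝ)))) _
    exact_mod_cast two_pow_le_diagProd hr n i
  exact ((PiLp.continuous_toLp 2 fun _ : Fin d => ℝ).tendsto 0).comp hcoord

/-- The mask of a digit set: the Fourier transform of its uniform measure. -/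
def mask (B : Finset (Fin d → ℤ)) (ξ : 𝔼 d) : ℂ :=
  (B.card : ℂ)⁻¹ * ∑ b ∈ B, expFun ξ (intVec b)

lemma mask_zero {B : Finset (Fin d → ℤ)} (hB : B.Nonempty) : mask B 0 = 1 := by
  simp [mask, hB.ne_empty]

lemma mask_add_intVec (B : Finset (Fin d → ℤ)) (ξ : 𝔼 d) (k : Fin d → ℤ) :
    mask B (ξ + intVec k) = mask B ξ := by
  simp [mask, expFun_add_left]

/-- The Fourier transform of the `n`-th finite convolution. -/
def maskProd (r : ℕ → Fin d → ℤ) (B : ℕ → Finset (Fin d → ℤ)) (n : ℕ) (ξ : 𝔼 d) : ℂ :=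
  ∏ j ∈ Finset.range n, mask (B j) (invScale (diagProd r (j + 1)) ξ)

lemma maskProd_succ (r : ℕ → Fin d → ℤ) (B : ℕ → Finset (Fin d → ℤ)) (n : ℕ) (ξ : 𝔼 d) :
    maskProd r B (n + 1) ξ =
      maskProd r B n ξ * mask (B n) (invScale (r n) (invScale (diagProd r n) ξ)) := by
  rw [invScale_invScale, ← diagProd_succ]
  exact Finset.prod_range_succ _ _

lemma maskProd_add (r : ℕ → Fin d → ℤ) (B : ℕ → Finset (Fin d → ℤ)) (n k : ℕ) (ξ : 𝔼 d) :
    maskProd r B (n + k) ξ = maskProd r B n ξ *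
      maskProd (fun j => r (n + j)) (fun j => B (n + j)) k (invScale (diagProd r n) ξ) := by
  simp only [maskProd, invScale_invScale, ← diagProd_add]
  exact Finset.prod_range_add _ _ _

lemma maskProd_one_add (r : ℕ → Fin d → ℤ) (B : ℕ → Finset (Fin d → ℤ)) (k : ℕ) (ξ : 𝔼 d) :
    maskProd r B (1 + k) ξ = mask (B 0) (invScale (r 0) ξ) *
      maskProd (fun j => r (1 + j)) (fun j => B (1 + j)) k (invScale (r 0) ξ) := by
  rw [maskProd_add]
  simp [maskProd, diagProd]

lemma maskProd_apply_zero (hB : ∀ n, (B n).Nonempty) (n : ℕ) : maskProd r B n 0 = 1 := by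
  simp [maskProd, mask_zero, hB]

lemma maskProd_add_intVec (hr : ∀ n i, r n i ≠ 0) (n : ℕ) (ξ : 𝔼 d) (k : Fin d → ℤ) :
    maskProd r B n (ξ + intVec (diagProd r n * k)) = maskProd r B n ξ := by
  induction n generalizing k with
  | zero => simp [maskProd]
  | succ n ih =>
    rw [maskProd_succ, maskProd_succ, diagProd_succ, mul_assoc, ih, map_add,
      invScale_intVec_mul (diagProd_ne_zero hr n), map_add, invScale_intVec_mul (hr n),
      mask_add_intVec]

end Products

section Tiles

variable {φ ψ : 𝔼 d → ℂ} {Λ L : Finset (Fin d → ℤ)} {P : Fin d → ℤ}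

/-- The translates of `‖φ‖²` by the elements of `Λ` sum to one; when `φ` is the Fourier transform
of a finitely supported measure, this says that `Λ` is a spectrum of it. -/
def IsTile (φ : 𝔼 d → ℂ) (Λ : Finset (Fin d → ℤ)) : Prop :=
  ∀ ξ, ∑ l ∈ Λ, ‖φ (ξ + intVec l)‖ ^ 2 = 1

open Classical in
lemma isTile_image {ι : Type*} (hφ : ‖φ 0‖ = 1) {s : Finset ι} {g : ι → Fin d → ℤ}
    (h : ∀ ξ, ∑ i ∈ s, ‖φ (ξ + intVec (g i))‖ ^ 2 = 1) : IsTile φ (s.image g) := by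
  intro ξ
  rw [Finset.sum_image, h]
  intro i hi j hj hij
  by_contra hne
  have hsum := Finset.hasSum s fun j => ‖φ (-intVec (g i) + intVec (g j))‖ ^ 2
  rw [h] at hsum
  have := eq_zero_of_hasSum_of_ne (fun _ => sq_nonneg _) hsum (i := ⟨i, hi⟩) (j := ⟨j, hj⟩)
    (by simp [hφ]) (by simpa using Ne.symm hne)
  simp [← hij, hφ] at this

open Classical in
lemma IsTile.image_add_mul (hφ : ‖φ 0‖ = 1) (hper : ∀ ξ k, φ (ξ + intVec (P * k)) = φ ξ)
    (hΛ : IsTile φ Λ) (g : (Fin d → ℤ) → Fin d → ℤ) :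
    IsTile φ (Λ.image fun l => l + P * g l) :=
  isTile_image hφ fun ξ => by simpa only [intVec_add, ← add_assoc, hper] using hΛ ξ

open Classical in
lemma IsTile.mul_comp_invScale (hP : ∀ i, P i ≠ 0) (hφ : ‖φ 0‖ = 1) (hψ : ‖ψ 0‖ = 1)
    (hper : ∀ ξ k, φ (ξ + intVec (P * k)) = φ ξ) (hΛ : IsTile φ Λ) (hL : IsTile ψ L) :
    IsTile (fun ξ => φ ξ * ψ (invScale P ξ)) ((Λ ×ˢ L).image fun q => q.1 + P * q.2) := by
  refine isTile_image (by simp [hφ, hψ]) fun ξ => ?_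
  rw [Finset.sum_product, ← hΛ ξ]
  refine Finset.sum_congr rfl fun l _ => ?_
  simp only [intVec_add, ← add_assoc, hper, map_add, invScale_intVec_mul hP, norm_mul,
    mul_pow]
  rw [← Finset.mul_sum, hL, mul_one]

variable {r : ℕ → Fin d → ℤ} {B : ℕ → Finset (Fin d → ℤ)}

lemma IsTile.exists_extension (hr : ∀ n i, r n i ≠ 0) (hB : ∀ n, (B n).Nonempty)
    (hL : ∀ n, ∃ L, 0 ∈ L ∧ IsTile (fun ξ => mask (B n) (invScale (r n) ξ)) L) {n n' : ℕ}
    (hn : n ≤ n') (hΛ : IsTile (maskProd r B n) Λ) :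
    ∃ Λ', Λ ⊆ Λ' ∧ IsTile (maskProd r B n') Λ' := by
  classical
  induction n', hn using Nat.le_induction with
  | base => exact ⟨Λ, subset_rfl, hΛ⟩
  | succ k _ ih =>
    obtain ⟨Λ₁, hΛΛ₁, hΛ₁⟩ := ih
    obtain ⟨L, hL0, hL⟩ := hL k
    refine ⟨(Λ₁ ×ˢ L).image fun q => q.1 + diagProd r k * q.2, hΛΛ₁.trans fun l hl =>
      Finset.mem_image.2 ⟨(l, 0), by simp [hl, hL0], by simp⟩, ?_⟩
    simpa only [← maskProd_succ] using hΛ₁.mul_comp_invScale (diagProd_ne_zero hr k)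
      (by rw [maskProd_apply_zero hB, norm_one])
      (by rw [map_zero, mask_zero (hB k), norm_one]) (maskProd_add_intVec hr k) hL

end Tiles

section Exhaustion

variable {α : Type*} {s : ℕ → Finset α} {f : ℕ → α → ℝ} {F : α → ℝ} {c C : ℝ}

/-- Tannery's theorem along an increasing sequence of finite sets. -/
theorem hasSum_of_exhaustion (hs : Monotone s) (hF : ∀ a, 0 ≤ F a)
    (hFf : ∀ j, ∀ a ∈ s j, F a ≤ f j a) (hsum : ∀ j, ∑ a ∈ s j, f j a = c)
    (hlim : ∀ a, Tendsto (fun j => f j a) atTop (𝓝 (F a)))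
    (hdom : ∀ᶠ j in atTop, ∀ a ∈ s j, f j a ≤ C * F a) :
    HasSum (fun a : ⋃ j, (s j : Set α) => F a) c := by
  let g : ℕ → (⋃ j, (s j : Set α)) → ℝ := fun j a => (s j : Set α).indicator (f j) a
  have hmem : ∀ a : ⋃ j, (s j : Set α), ∀ᶠ j in atTop, (a : α) ∈ s j := fun a => by
    obtain ⟨i, hi⟩ := Set.mem_iUnion.1 a.2
    exact eventually_atTop.2 ⟨i, fun j hj => hs hj hi⟩
  have hg_nonneg : ∀ j a, 0 ≤ g j a := fun j a =>
    Set.indicator_nonneg (fun b hb => (hF b).trans (hFf j b hb)) _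
  have hg_sum : ∀ j, HasSum (g j) c := fun j => by
    refine (hasSum_subtype_iff_of_support_subset ?_).2
      (hasSum_subtype_iff_indicator.1 (hsum j ▸ (s j).hasSum (f j)))
    exact Set.support_indicator_subset.trans (Set.subset_iUnion (fun j => (s j : Set α)) j)
  have hsummable : Summable fun a : ⋃ j, (s j : Set α) => F a := by
    refine summable_of_sum_le (c := c) (fun a => hF a) fun u => ?_
    obtain ⟨j, hj⟩ := (u.eventually_all.2 fun a _ => hmem a).exists
    calc ∑ a ∈ u, F a ≤ ∑ a ∈ u, g j a := Finset.sum_le_sum fun a ha => by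
          simpa only [g, Set.indicator_of_mem (Finset.mem_coe.2 (hj a ha))] using hFf j a (hj a ha)
      _ ≤ c := sum_le_hasSum u (fun a _ => hg_nonneg j a) (hg_sum j)
  have hg_lim : ∀ a, Tendsto (fun j => g j a) atTop (𝓝 (F a)) := fun a =>
    (hlim a).congr' ((hmem a).mono fun j hj => (Set.indicator_of_mem (Finset.mem_coe.2 hj) _).symm)
  have hg_dom : ∀ᶠ j in atTop, ∀ a, ‖g j a‖ ≤ |C| * F a := hdom.mono fun j hj a => by
    rw [Real.norm_of_nonneg (hg_nonneg j a)]
    refine Set.indicator_apply_le' (fun ha => (hj a ha).trans ?_) fun _ =>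
      mul_nonneg (abs_nonneg C) (hF a)
    exact mul_le_mul_of_nonneg_right (le_abs_self C) (hF a)
  have hconst := tendsto_tsum_of_dominated_convergence (hsummable.mul_left |C|) hg_lim hg_dom
  simp only [(hg_sum _).tsum_eq] at hconst
  exact tendsto_nhds_unique hconst tendsto_const_nhds ▸ hsummable.hasSum

end Exhaustion

section EquiPositivity

/-- Every point has an integer translate, namely itself for the origin, on whose `δ`-neighbourhood
`‖φ‖ ≥ ε`. Uniformity of `ε` and `δ` in a family of functions `φ` is the equi-positivity of
An, Fu and Lai. -/
def IsLatticePositive (ε δ : ℝ) (φ : 𝔼 d → ℂ) : Prop :=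
  ∀ x, ∃ k : Fin d → ℤ, (x = 0 → k = 0) ∧ ∀ y, ‖y‖ < δ → ε ≤ ‖φ (x + intVec k + y)‖

variable {ε δ : ℝ}

open Classical in
lemma IsLatticePositive.exists_image_le_norm {φ : 𝔼 d → ℂ} (hφ : IsLatticePositive ε δ φ)
    {P : Fin d → ℤ} (hP : ∀ i, P i ≠ 0) (S : Finset (Fin d → ℤ))
    (hS : ∀ l ∈ S, ‖invScale P (intVec l)‖ < δ / 2) (Λ : Finset (Fin d → ℤ)) :
    ∃ g : (Fin d → ℤ) → Fin d → ℤ, (∀ l ∈ S, g l = 0) ∧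
      ∀ l ∈ Λ.image fun l => l + P * g l, ∀ y, ‖y‖ < δ / 2 →
        ε ≤ ‖φ (invScale P (intVec l) + y)‖ := by
  choose k hk0 hk using hφ
  -- Points of `S` are close to the origin after scaling, and need not be moved.
  let x : (Fin d → ℤ) → 𝔼 d := fun l => if l ∈ S then 0 else invScale P (intVec l)
  refine ⟨fun l => k (x l), fun l hl => hk0 _ (if_pos hl), fun l' hl' y hy => ?_⟩
  obtain ⟨l, -, rfl⟩ := Finset.mem_image.1 hl'
  have hx : ‖invScale P (intVec l) - x l‖ ≤ δ / 2 := by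
    by_cases hl : l ∈ S
    · simpa only [x, if_pos hl, sub_zero] using (hS l hl).le
    · simpa only [x, if_neg hl, sub_self, norm_zero] using (norm_nonneg y).trans hy.le
  have hy' : ‖invScale P (intVec l) - x l + y‖ < δ := (norm_add_le _ _).trans_lt (by linarith)
  convert hk (x l) _ hy' using 3
  rw [intVec_add, map_add, invScale_intVec_mul hP]
  abel

variable {r : ℕ → Fin d → ℤ} {B : ℕ → Finset (Fin d → ℤ)} {φ : ℕ → 𝔼 d → ℂ}
  {Λ : Finset (Fin d → ℤ)}

lemma IsTile.exists_extension_le_norm (hr : ∀ n i, 2 ≤ r n i) (hB : ∀ n, (B n).Nonempty)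
    (hL : ∀ n, ∃ L, 0 ∈ L ∧ IsTile (fun ξ => mask (B n) (invScale (r n) ξ)) L) (hδ : 0 < δ)
    (hφ : ∃ᶠ n in atTop, IsLatticePositive ε δ (φ n)) {n : ℕ} (hΛ : IsTile (maskProd r B n) Λ) :
    ∃ n' Λ', n < n' ∧ Λ ⊆ Λ' ∧ IsTile (maskProd r B n') Λ' ∧ ∀ l ∈ Λ', ∀ y, ‖y‖ < δ / 2 →
      ε ≤ ‖φ n' (invScale (diagProd r n') (intVec l) + y)‖ := by
  classical
  have hr0 : ∀ n i, r n i ≠ 0 := fun n i => by have := hr n i; lia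
  have hsmall : ∀ᶠ n' in atTop, ∀ l ∈ Λ, ‖invScale (diagProd r n') (intVec l)‖ < δ / 2 :=
    Λ.eventually_all.2 fun l _ =>
      (tendsto_invScale_diagProd hr (intVec l)).norm.eventually_lt_const (by simpa using hδ)
  obtain ⟨n', hφn', hΛn', hn'⟩ := (hφ.and_eventually (hsmall.and (eventually_gt_atTop n))).exists
  obtain ⟨Λ₁, hΛΛ₁, hΛ₁⟩ := hΛ.exists_extension hr0 hB hL hn'.le
  obtain ⟨g, hg0, hg⟩ := hφn'.exists_image_le_norm (diagProd_ne_zero hr0 n') Λ hΛn' Λ₁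
  refine ⟨n', Λ₁.image fun l => l + diagProd r n' * g l, hn', fun l hl =>
    Finset.mem_image.2 ⟨l, hΛΛ₁ hl, by simp [hg0 l hl]⟩, ?_, hg⟩
  exact hΛ₁.image_add_mul (by rw [maskProd_apply_zero hB, norm_one]) (maskProd_add_intVec hr0 n') g

lemma exists_monotone_isTile (hr : ∀ n i, 2 ≤ r n i) (hB : ∀ n, (B n).Nonempty)
    (hL : ∀ n, ∃ L, 0 ∈ L ∧ IsTile (fun ξ => mask (B n) (invScale (r n) ξ)) L) (hδ : 0 < δ)
    (hφ : ∃ᶠ n in atTop, IsLatticePositive ε δ (φ n)) :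
    ∃ (N : ℕ → ℕ) (Λ : ℕ → Finset (Fin d → ℤ)), StrictMono N ∧ Monotone Λ ∧
      ∀ j, IsTile (maskProd r B (N j)) (Λ j) ∧ ∀ l ∈ Λ j, ∀ y, ‖y‖ < δ / 2 →
        ε ≤ ‖φ (N j) (invScale (diagProd r (N j)) (intVec l) + y)‖ := by
  let T := {q : ℕ × Finset (Fin d → ℤ) // IsTile (maskProd r B q.1) q.2 ∧ ∀ l ∈ q.2, ∀ y,
    ‖y‖ < δ / 2 → ε ≤ ‖φ q.1 (invScale (diagProd r q.1) (intVec l) + y)‖}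
  have hnext : ∀ n Λ, IsTile (maskProd r B n) Λ → ∃ t : T, n < t.1.1 ∧ Λ ⊆ t.1.2 :=
    fun n Λ h => by
      obtain ⟨n', Λ', hn, hΛ, h'⟩ := h.exists_extension_le_norm hr hB hL hδ hφ
      exact ⟨⟨(n', Λ'), h'⟩, hn, hΛ⟩
  obtain ⟨t₀, -⟩ := hnext 0 {0} fun ξ => by simp [maskProd]
  choose next hlt hsub using fun t : T => hnext t.1.1 t.1.2 t.2.1
  let s : ℕ → T := fun j => next^[j] t₀
  have hs : ∀ j, s (j + 1) = next (s j) := fun j => Function.iterate_succ_apply' _ _ _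
  exact ⟨fun j => (s j).1.1, fun j => (s j).1.2, strictMono_nat_of_lt_succ fun j => hs j ▸ hlt _,
    monotone_nat_of_le_succ fun j => hs j ▸ hsub _, fun j => (s j).2⟩

/-- Equi-positivity of the tails `φ n` yields Parseval's identity for the infinite product
`φ 0`. -/
theorem exists_hasSum_norm_sq (hr : ∀ n i, 2 ≤ r n i) (hB : ∀ n, (B n).Nonempty)
    (hL : ∀ n, ∃ L, 0 ∈ L ∧ IsTile (fun ξ => mask (B n) (invScale (r n) ξ)) L)
    (hφ_le : ∀ n ξ, ‖φ n ξ‖ ≤ 1)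
    (hφ_mul : ∀ n ξ, φ 0 ξ = maskProd r B n ξ * φ n (invScale (diagProd r n) ξ))
    (hφ_lim : ∀ ξ, Tendsto (fun n => maskProd r B n ξ) atTop (𝓝 (φ 0 ξ)))
    (hε : 0 < ε) (hδ : 0 < δ) (hφ : ∃ᶠ n in atTop, IsLatticePositive ε δ (φ n)) :
    ∃ Λ : Set (Fin d → ℤ), ∀ ξ, HasSum (fun a : Λ => ‖φ 0 (ξ + intVec a)‖ ^ 2) 1 := by
  obtain ⟨N, Λ, hN, hΛ, hNΛ⟩ := exists_monotone_isTile hr hB hL hδ hφ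
  refine ⟨⋃ j, Λ j, fun ξ => hasSum_of_exhaustion (C := (ε ^ 2)⁻¹)
    (f := fun j a => ‖maskProd r B (N j) (ξ + intVec a)‖ ^ 2)
    (F := fun a => ‖φ 0 (ξ + intVec a)‖ ^ 2) hΛ (fun _ => sq_nonneg _) (fun j a _ => ?_)
    (fun j => (hNΛ j).1 ξ)
    (fun a => ((hφ_lim _).comp hN.tendsto_atTop).norm.pow 2) ?_⟩
  · rw [hφ_mul (N j), norm_mul]
    gcongr
    exact mul_le_of_le_one_right (norm_nonneg _) (hφ_le _ _)
  · have hsmall : ∀ᶠ j in atTop, ‖invScale (diagProd r (N j)) ξ‖ < δ / 2 :=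
      ((tendsto_invScale_diagProd hr ξ).comp hN.tendsto_atTop).norm.eventually_lt_const
        (by simpa using hδ)
    filter_upwards [hsmall] with j hj a ha
    rw [hφ_mul (N j), norm_mul, mul_pow, map_add, add_comm (invScale _ ξ), mul_left_comm]
    refine le_mul_of_one_le_right (sq_nonneg _) ?_
    rw [one_le_inv_mul₀ (by positivity)]
    gcongr
    exact (hNΛ j).2 a ha _ hj

end EquiPositivity

section Admissible

lemma sum_norm_sq_vecMul {𝕜 m n : Type*} [RCLike 𝕜] [Fintype m] [Fintype n] [DecidableEq m]
    {A : Matrix m n 𝕜} (hA : A * A.conjTranspose = 1) (u : m → 𝕜) :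
    ∑ l, ‖Matrix.vecMul u A l‖ ^ 2 = ∑ b, ‖u b‖ ^ 2 := by
  have hdot : Matrix.vecMul u A ⬝ᵥ star (Matrix.vecMul u A) = u ⬝ᵥ star u := by
    rw [Matrix.star_vecMul, Matrix.dotProduct_mulVec, Matrix.vecMul_vecMul, hA, Matrix.vecMul_one]
  simp only [dotProduct, Pi.star_apply, RCLike.star_def, RCLike.mul_conj] at hdot
  exact_mod_cast hdot

open Classical in
lemma IsTile.exists_zero_mem {φ : 𝔼 d → ℂ} {L : Finset (Fin d → ℤ)} (hφ : ‖φ 0‖ = 1)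
    (hL : IsTile φ L) : ∃ L', 0 ∈ L' ∧ IsTile φ L' := by
  obtain ⟨l₀, hl₀⟩ : L.Nonempty := by
    rw [Finset.nonempty_iff_ne_empty]
    rintro rfl
    simpa using hL 0
  refine ⟨L.image fun l => l - l₀, Finset.mem_image.2 ⟨l₀, hl₀, sub_self _⟩,
    isTile_image hφ fun ξ => ?_⟩
  simpa only [intVec_sub, add_sub_left_comm, sub_add_eq_add_sub, add_sub_assoc] using
    hL (ξ - intVec l₀)

variable {m : Fin d → ℤ} {B L : Finset (Fin d → ℤ)}

lemma hadamardMatrix_diagonal_apply (hm : ∀ i, m i ≠ 0) (b : B) (l : L) :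
    hadamardMatrix (Matrix.diagonal m) B L b l = ((1 / √B.card : ℝ) : ℂ) *
      conj (expFun (invScale m (intVec l.1)) (intVec b.1)) := by
  rw [hadamardMatrix, Matrix.of_apply, invApply_diagonal hm, ← expFun_neg_left, expFun,
    inner_neg_left, inner_invScale_left, real_inner_comm]
  push_cast
  ring_nf

lemma isTile_mask (hm : ∀ i, m i ≠ 0) (hB : B.Nonempty)
    (hH : hadamardMatrix (Matrix.diagonal m) B L *
      (hadamardMatrix (Matrix.diagonal m) B L).conjTranspose = 1) :
    IsTile (fun ξ => mask B (invScale m ξ)) L := by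
  intro ξ
  let c : ℂ := (1 / √B.card : ℝ)
  have hc : c * c = (B.card : ℂ)⁻¹ := by
    rw [← Complex.ofReal_mul, one_div, ← mul_inv, Real.mul_self_sqrt (Nat.cast_nonneg _)]
    simp
  let u : B → ℂ := fun b => c * conj (expFun (invScale m ξ) (intVec b.1))
  have hu : ∀ b, ‖u b‖ ^ 2 = (B.card : ℝ)⁻¹ := fun b => by simp [u, c]
  have hmask : ∀ l : L, mask B (invScale m (ξ + intVec l.1)) =
      conj (Matrix.vecMul u (hadamardMatrix (Matrix.diagonal m) B L) l) := fun l => by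
    simp only [Matrix.vecMul, dotProduct, hadamardMatrix_diagonal_apply hm, u, map_sum, map_mul,
      Complex.conj_conj, mask, Finset.mul_sum, map_add, expFun_add_left, ← hc]
    rw [← Finset.sum_coe_sort B]
    refine Finset.sum_congr rfl fun b _ => ?_
    simp only [c, Complex.conj_ofReal]
    ring
  rw [← Finset.sum_coe_sort L]
  simp only [hmask, RCLike.norm_conj, sum_norm_sq_vecMul hH, hu]
  simp [hB.ne_empty]

lemma IsAdmissiblePair.exists_isTile (hm : ∀ i, m i ≠ 0) (hB : B.Nonempty)
    (h : IsAdmissiblePair (Matrix.diagonal m) B) :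
    ∃ L, 0 ∈ L ∧ IsTile (fun ξ => mask B (invScale m ξ)) L := by
  obtain ⟨-, L, -, hH, -⟩ := h
  exact (isTile_mask hm hB hH).exists_zero_mem (by rw [map_zero, mask_zero hB, norm_one])

end Admissible

section FiniteConvolutions

variable {m : Fin d → ℤ}

lemma invApply_injective (hm : ∀ i, m i ≠ 0) : Function.Injective (invApply (Matrix.diagonal m)) :=
  fun b c h => intVec_injective <| by
    rw [invApply_diagonal hm, invApply_diagonal hm] at h
    ext i
    have := congrArg (fun x : 𝔼 d => x i) h
    simpa [div_left_inj', hm i] using this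

lemma isProbabilityMeasure_discreteMeasure {A : Finset (𝔼 d)} (hA : A.Nonempty) :
    IsProbabilityMeasure (discreteMeasure A) where
  measure_univ := by simp [discreteMeasure, ENNReal.inv_mul_cancel, hA.ne_empty]

lemma fourierTransform_discreteMeasure_invImage (hm : ∀ i, m i ≠ 0) (B : Finset (Fin d → ℤ))
    (ξ : 𝔼 d) :
    fourierTransform (discreteMeasure (invImage (Matrix.diagonal m) B)) ξ =
      mask B (invScale m ξ) := by
  classical
  rw [fourierTransform, discreteMeasure, integral_smul_measure,
    integral_finsetSum_measure fun _ _ => integrable_expFun ξ, invImage,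
    Finset.card_image_of_injective _ (invApply_injective hm),
    Finset.sum_image (invApply_injective hm).injOn]
  simp [mask, invApply_diagonal hm, expFun_invScale_left]

lemma fourierTransform_conv (μ ν : Measure (𝔼 d)) [IsFiniteMeasure μ] [IsFiniteMeasure ν]
    (ξ : 𝔼 d) :
    fourierTransform (μ.conv ν) ξ = fourierTransform μ ξ * fourierTransform ν ξ := by
  simp only [fourierTransform_eq_charFun, charFun_conv]

lemma isProbabilityMeasure_finiteConvolution (R : ℕ → Matrix (Fin d) (Fin d) ℤ)
    {B : ℕ → Finset (Fin d → ℤ)} (hB : ∀ n, (B n).Nonempty) (n : ℕ) :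
    IsProbabilityMeasure (finiteConvolution R B n) := by
  classical
  induction n with
  | zero => exact Measure.dirac.isProbabilityMeasure
  | succ n ih =>
    have := isProbabilityMeasure_discreteMeasure ((hB n).image (invApply (matProd R (n + 1))))
    rw [finiteConvolution, invImage]
    infer_instance

variable {r : ℕ → Fin d → ℤ}

lemma matProd_diagonal (r : ℕ → Fin d → ℤ) (n : ℕ) :
    matProd (fun j => Matrix.diagonal (r j)) n = Matrix.diagonal (diagProd r n) := by
  induction n with
  | zero => exact Matrix.diagonal_one.symm
  | succ n ih =>
    rw [matProd, ih, Matrix.diagonal_mul_diagonal', diagProd_succ, mul_comm]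
    rfl

lemma fourierTransform_finiteConvolution (hr : ∀ n i, r n i ≠ 0) {B : ℕ → Finset (Fin d → ℤ)}
    (hB : ∀ n, (B n).Nonempty) (n : ℕ) (ξ : 𝔼 d) :
    fourierTransform (finiteConvolution (fun j => Matrix.diagonal (r j)) B n) ξ =
      maskProd r B n ξ := by
  classical
  induction n with
  | zero => simp [finiteConvolution, fourierTransform, maskProd]
  | succ n ih =>
    have := isProbabilityMeasure_finiteConvolution (fun j => Matrix.diagonal (r j)) hB n
    have : IsProbabilityMeasure
        (discreteMeasure (invImage (Matrix.diagonal (diagProd r (n + 1))) (B n))) :=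
      isProbabilityMeasure_discreteMeasure ((hB n).image _)
    rw [finiteConvolution, matProd_diagonal, fourierTransform_conv, ih, maskProd_succ,
      fourierTransform_discreteMeasure_invImage (diagProd_ne_zero hr (n + 1)), invScale_invScale,
      diagProd_succ]

end FiniteConvolutions

section PrependDigit

variable {m : Fin d → ℤ} {B : Finset (Fin d → ℤ)} {ν : Measure (𝔼 d)}

lemma continuous_invScale_intVec_add (m b : Fin d → ℤ) :
    Continuous fun x : 𝔼 d => invScale m (intVec b + x) := by fun_prop

/-- The convolution of the uniform measure on `m⁻¹ B` with `ν` scaled by `m⁻¹`. In terms of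
`m`-adic expansions, `prependDigit` shifts the digits of `ν` and inserts a uniformly distributed
first digit from `B`. -/
def prependDigit (m : Fin d → ℤ) (B : Finset (Fin d → ℤ)) (ν : Measure (𝔼 d)) : Measure (𝔼 d) :=
  (B.card : ℝ≥0∞)⁻¹ • ∑ b ∈ B, ν.map fun x => invScale m (intVec b + x)

lemma isProbabilityMeasure_prependDigit [IsProbabilityMeasure ν] (hB : B.Nonempty) :
    IsProbabilityMeasure (prependDigit m B ν) where
  measure_univ := by
    have hmap : ∀ b, ν.map (fun x => invScale m (intVec b + x)) Set.univ = 1 := fun b => by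
      rw [Measure.map_apply (continuous_invScale_intVec_add m b).measurable .univ,
        Set.preimage_univ, measure_univ]
    simp [prependDigit, -map_add, hmap, ENNReal.inv_mul_cancel, hB.ne_empty]

lemma fourierTransform_prependDigit [IsFiniteMeasure ν] (m : Fin d → ℤ) (B : Finset (Fin d → ℤ))
    (ξ : 𝔼 d) :
    fourierTransform (prependDigit m B ν) ξ =
      mask B (invScale m ξ) * fourierTransform ν (invScale m ξ) := by
  have hmap : ∀ b, ∫ x, expFun ξ x ∂(ν.map fun x => invScale m (intVec b + x)) =
      expFun (invScale m ξ) (intVec b) * fourierTransform ν (invScale m ξ) := fun b => by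
    rw [integral_map (continuous_invScale_intVec_add m b).aemeasurable
      (continuous_expFun ξ).aestronglyMeasurable, fourierTransform, ← integral_const_mul]
    simp only [← expFun_invScale_left, expFun_add_right]
  rw [fourierTransform, prependDigit, integral_smul_measure,
    integral_finsetSum_measure fun _ _ => integrable_expFun ξ]
  simp only [hmap, ← Finset.sum_mul, mask, mul_assoc]
  simp

lemma ae_prependDigit {p : 𝔼 d → Prop} (hp : MeasurableSet {x | p x})
    (h : ∀ b ∈ B, ∀ᵐ x ∂ν, p (invScale m (intVec b + x))) : ∀ᵐ x ∂prependDigit m B ν, p x := by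
  refine Measure.ae_smul_measure (ae_finsetSum_measure_iff.2 fun b hb => ?_) _
  exact (ae_map_iff (continuous_invScale_intVec_add m b).aemeasurable hp).2 (h b hb)

lemma mem_support_prependDigit {b : Fin d → ℤ} (hb : b ∈ B) {x : 𝔼 d} (hx : x ∈ ν.support) :
    invScale m (intVec b + x) ∈ (prependDigit m B ν).support := by
  rw [Measure.mem_support_iff_forall] at hx ⊢
  intro U hU
  have hcont := continuous_invScale_intVec_add m b
  rw [prependDigit, Measure.smul_apply, Measure.finsetSum_apply]
  refine ENNReal.mul_pos (by simp) (ne_of_gt ?_)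
  calc 0 < ν ((fun x => invScale m (intVec b + x)) ⁻¹' U) :=
        hx _ (hcont.continuousAt.preimage_mem_nhds hU)
    _ ≤ ν.map (fun x => invScale m (intVec b + x)) U := Measure.le_map_apply hcont.aemeasurable U
    _ ≤ ∑ c ∈ B, ν.map (fun x => invScale m (intVec c + x)) U :=
        Finset.single_le_sum (f := fun c => ν.map (fun x => invScale m (intVec c + x)) U)
          (fun _ _ => zero_le) hb

end PrependDigit

section Cube

variable {m : Fin d → ℤ} {B : Finset (Fin d → ℤ)} {ν : Measure (𝔼 d)}

/-- The closed unit cube. -/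
def cube (d : ℕ) : Set (𝔼 d) := {x | ∀ i, x i ∈ Set.Icc (0 : ℝ) 1}

lemma isCompact_cube : IsCompact (cube d) := by
  have hpi := isCompact_univ_pi fun _ : Fin d => isCompact_Icc (a := (0 : ℝ)) (b := 1)
  convert (EuclideanSpace.equiv (Fin d) ℝ).toHomeomorph.isCompact_preimage.2 hpi
  ext x
  simp [cube, Pi.le_def, forall_and]

/-- The digits `b i` lie in `{0, …, m i - 1}`. -/
def IsDigitSet (m : Fin d → ℤ) (B : Finset (Fin d → ℤ)) : Prop :=
  ∀ b ∈ B, ∀ i, 0 ≤ b i ∧ b i ≤ m i - 1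

lemma IsDigitSet.invScale_mem_cube (hB : IsDigitSet m B) {b : Fin d → ℤ} (hb : b ∈ B) {x : 𝔼 d}
    (hx : x ∈ cube d) : invScale m (intVec b + x) ∈ cube d := by
  intro i
  obtain ⟨hb0, hb1⟩ := hB b hb i
  have hb0' : (0 : ℝ) ≤ b i := by exact_mod_cast hb0
  have hb1' : (b i : ℝ) ≤ m i - 1 := by exact_mod_cast hb1
  obtain ⟨hx0, hx1⟩ := hx i
  rw [invScale_apply, PiLp.add_apply, intVec_apply]
  exact ⟨div_nonneg (by linarith) (by linarith), div_le_one_of_le₀ (by linarith) (by linarith)⟩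

lemma IsDigitSet.ae_prependDigit_mem_cube (hB : IsDigitSet m B) (hν : ∀ᵐ x ∂ν, x ∈ cube d) :
    ∀ᵐ x ∂prependDigit m B ν, x ∈ cube d :=
  ae_prependDigit isCompact_cube.measurableSet fun _ hb => hν.mono fun _ => hB.invScale_mem_cube hb

lemma finiteConvolution_succ_eq_prependDigit {r : ℕ → Fin d → ℤ} (hr : ∀ n i, r n i ≠ 0)
    {B : ℕ → Finset (Fin d → ℤ)} (hB : ∀ n, (B n).Nonempty) (n : ℕ) :
    finiteConvolution (fun j => Matrix.diagonal (r j)) B (n + 1) = prependDigit (r 0) (B 0)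
      (finiteConvolution (fun j => Matrix.diagonal (r (1 + j))) (fun j => B (1 + j)) n) := by
  have := isProbabilityMeasure_finiteConvolution (fun j => Matrix.diagonal (r j)) hB (n + 1)
  have := isProbabilityMeasure_finiteConvolution (fun j => Matrix.diagonal (r (1 + j)))
    (fun j => hB (1 + j)) n
  have := isProbabilityMeasure_prependDigit (m := r 0) (ν := finiteConvolution
    (fun j => Matrix.diagonal (r (1 + j))) (fun j => B (1 + j)) n) (hB 0)
  refine Measure.ext_of_charFun (funext fun t => ?_)
  rw [charFun_eq_fourierTransform, charFun_eq_fourierTransform, fourierTransform_prependDigit,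
    fourierTransform_finiteConvolution hr hB, add_comm n, maskProd_one_add,
    fourierTransform_finiteConvolution (fun _ => hr _) fun _ => hB _]

lemma ae_finiteConvolution_mem_cube {r : ℕ → Fin d → ℤ} (hr : ∀ n i, r n i ≠ 0)
    {B : ℕ → Finset (Fin d → ℤ)} (hB : ∀ n, (B n).Nonempty) (hdig : ∀ n, IsDigitSet (r n) (B n))
    (n : ℕ) :
    ∀ᵐ x ∂finiteConvolution (fun j => Matrix.diagonal (r j)) B n, x ∈ cube d := by
  induction n generalizing r B with
  | zero =>
    rw [finiteConvolution, ae_dirac_eq]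
    simp [cube]
  | succ n ih =>
    rw [finiteConvolution_succ_eq_prependDigit hr hB]
    exact (hdig 0).ae_prependDigit_mem_cube (ih (fun _ => hr _) (fun _ => hB _) fun _ => hdig _)

end Cube

section WeakLimit

/-- The probability measures carried by the unit cube. -/
def cubeMeasures (d : ℕ) : Set (ProbabilityMeasure (𝔼 d)) :=
  {μ | ∀ᵐ x ∂(μ : Measure (𝔼 d)), x ∈ cube d}

lemma isCompact_cubeMeasures : IsCompact (cubeMeasures d) := by
  have h := isCompact_setOfPred_probabilityMeasure_mass_eq_compl_isCompact_le
    (E := 𝔼 d) (u := fun _ => 0) (K := fun _ => cube d) tendsto_const_nhds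
    (fun _ => isCompact_cube) (Or.inl inferInstance)
  convert h using 1
  ext μ
  simp [cubeMeasures, ae_iff, Set.compl_def]

lemma exists_lipschitzWith_fourierTransform (d : ℕ) :
    ∃ K, ∀ μ ∈ cubeMeasures d, LipschitzWith K (fourierTransform (μ : Measure (𝔼 d))) := by
  obtain ⟨C, hC⟩ := (isCompact_cube (d := d)).isBounded.exists_norm_le
  refine ⟨(2 * Real.pi * C).toNNReal, fun μ hμ => .of_dist_le_mul fun ξ η => ?_⟩
  have hbound : ∀ᵐ x ∂(μ : Measure (𝔼 d)), ‖x‖ ≤ C := Eventually.mono hμ hC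
  rw [dist_eq_norm, dist_eq_norm]
  refine (norm_fourierTransform_sub_le hbound ξ η).trans ?_
  gcongr
  exact Real.le_coe_toNNReal _

lemma continuous_fourierTransform_measure (ξ : 𝔼 d) :
    Continuous fun μ : ProbabilityMeasure (𝔼 d) => fourierTransform (μ : Measure (𝔼 d)) ξ :=
  continuous_iff_continuousAt.2 fun _ =>
    (ProbabilityMeasure.tendsto_iff_forall_integral_rclike_tendsto ℂ).1 tendsto_id
      (.ofNormedAddCommGroup (expFun ξ) (continuous_expFun ξ) 1 fun x => (norm_expFun ξ x).le)

variable {r : ℕ → Fin d → ℤ} {B : ℕ → Finset (Fin d → ℤ)}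

lemma norm_maskProd_le_one (hr : ∀ n i, r n i ≠ 0) (hB : ∀ n, (B n).Nonempty) (n : ℕ) (ξ : 𝔼 d) :
    ‖maskProd r B n ξ‖ ≤ 1 := by
  have := isProbabilityMeasure_finiteConvolution (fun j => Matrix.diagonal (r j)) hB n
  rw [← fourierTransform_finiteConvolution hr hB]
  exact norm_fourierTransform_le_one ξ

lemma cauchySeq_maskProd (hr : ∀ n i, 2 ≤ r n i) (hB : ∀ n, (B n).Nonempty)
    (hdig : ∀ n, IsDigitSet (r n) (B n)) (ξ : 𝔼 d) : CauchySeq fun n => maskProd r B n ξ := by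
  have hr0 : ∀ n i, r n i ≠ 0 := fun n i => by have := hr n i; lia
  obtain ⟨K, hK⟩ := exists_lipschitzWith_fourierTransform d
  refine cauchySeq_of_le_tendsto_0' (fun n => K * ‖invScale (diagProd r n) ξ‖) ?_
    (by simpa using (tendsto_invScale_diagProd hr ξ).norm.const_mul (K : ℝ))
  intro n m hnm
  obtain ⟨k, rfl⟩ := exists_add_of_le hnm
  let μ : ProbabilityMeasure (𝔼 d) := ⟨finiteConvolution (fun j => Matrix.diagonal (r (n + j)))
    (fun j => B (n + j)) k, isProbabilityMeasure_finiteConvolution _ (fun _ => hB _) k⟩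
  have hμ_cube : μ ∈ cubeMeasures d :=
    ae_finiteConvolution_mem_cube (fun _ => hr0 _) (fun _ => hB _) (fun _ => hdig _) k
  have htail : ‖fourierTransform (μ : Measure (𝔼 d)) (invScale (diagProd r n) ξ) - 1‖ ≤
      K * ‖invScale (diagProd r n) ξ‖ := by
    have h := (hK μ hμ_cube).dist_le_mul (invScale (diagProd r n) ξ) 0
    rwa [fourierTransform_zero, dist_zero_right, dist_eq_norm] at h
  rw [dist_comm, dist_eq_norm, maskProd_add,
    ← fourierTransform_finiteConvolution (fun _ => hr0 _) (fun _ => hB _) k, ← mul_sub_one,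
    norm_mul]
  exact (mul_le_of_le_one_left (norm_nonneg _) (norm_maskProd_le_one hr0 hB n ξ)).trans htail

theorem exists_isInfiniteConvolution (hr : ∀ n i, 2 ≤ r n i) (hB : ∀ n, (B n).Nonempty)
    (hdig : ∀ n, IsDigitSet (r n) (B n)) :
    ∃ μ ∈ cubeMeasures d, IsInfiniteConvolution (fun n => Matrix.diagonal (r n)) B μ := by
  have hr0 : ∀ n i, r n i ≠ 0 := fun n i => by have := hr n i; lia
  let ν : ℕ → ProbabilityMeasure (𝔼 d) := fun n =>
    ⟨finiteConvolution (fun j => Matrix.diagonal (r j)) B n,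
      isProbabilityMeasure_finiteConvolution _ hB n⟩
  have hν : ∀ n ξ, fourierTransform (ν n : Measure (𝔼 d)) ξ = maskProd r B n ξ :=
    fourierTransform_finiteConvolution hr0 hB
  obtain ⟨μ, hμ, hcluster⟩ := isCompact_cubeMeasures.exists_mapClusterPt (f := atTop) (u := ν)
    (tendsto_principal.2 (.of_forall (ae_finiteConvolution_mem_cube hr0 hB hdig)))
  have hlim : ∀ ξ, Tendsto (fun n => maskProd r B n ξ) atTop
      (𝓝 (fourierTransform (μ : Measure (𝔼 d)) ξ)) := by
    intro ξ
    obtain ⟨z, hz⟩ := cauchySeq_tendsto_of_complete (cauchySeq_maskProd hr hB hdig ξ)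
    have hcluster' := hcluster.tendsto_comp (continuous_fourierTransform_measure ξ).continuousAt
    simp only [Function.comp_def, hν] at hcluster'
    have : (𝓝 (fourierTransform (μ : Measure (𝔼 d)) ξ) ⊓ 𝓝 z).NeBot :=
      hcluster'.neBot.mono (inf_le_inf_left _ hz)
    rwa [eq_of_nhds_neBot this]
  have hconv : Tendsto ν atTop (𝓝 μ) :=
    ProbabilityMeasure.tendsto_of_tendsto_charFun fun t => by
      simpa only [charFun_eq_fourierTransform, hν] using hlim _
  exact ⟨μ, hμ, inferInstance, ProbabilityMeasure.tendsto_iff_forall_integral_tendsto.1 hconv⟩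

lemma IsInfiniteConvolution.tendsto_maskProd (hr : ∀ n i, r n i ≠ 0) (hB : ∀ n, (B n).Nonempty)
    {μ : Measure (𝔼 d)} (hμ : IsInfiniteConvolution (fun n => Matrix.diagonal (r n)) B μ)
    (ξ : 𝔼 d) : Tendsto (fun n => maskProd r B n ξ) atTop (𝓝 (fourierTransform μ ξ)) := by
  have := hμ.1
  let ν : ℕ → ProbabilityMeasure (𝔼 d) := fun n =>
    ⟨finiteConvolution (fun j => Matrix.diagonal (r j)) B n,
      isProbabilityMeasure_finiteConvolution _ hB n⟩
  have hν : Tendsto ν atTop (𝓝 ⟨μ, hμ.1⟩) :=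
    ProbabilityMeasure.tendsto_iff_forall_integral_tendsto.2 hμ.2
  refine (((continuous_fourierTransform_measure ξ).tendsto _).comp hν).congr fun n => ?_
  exact fourierTransform_finiteConvolution hr hB n ξ

lemma IsInfiniteConvolution.fourierTransform_eq_maskProd_mul (hr : ∀ n i, r n i ≠ 0)
    (hB : ∀ n, (B n).Nonempty) {μ ν : Measure (𝔼 d)} {n : ℕ}
    (hμ : IsInfiniteConvolution (fun j => Matrix.diagonal (r j)) B μ)
    (hν : IsInfiniteConvolution (fun j => Matrix.diagonal (r (n + j))) (fun j => B (n + j)) ν)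
    (ξ : 𝔼 d) :
    fourierTransform μ ξ = maskProd r B n ξ * fourierTransform ν (invScale (diagProd r n) ξ) := by
  have htail := hν.tendsto_maskProd (fun _ => hr _) (fun _ => hB _) (invScale (diagProd r n) ξ)
  have hshift : Tendsto (fun k => n + k) atTop atTop :=
    tendsto_atTop_mono (fun k => Nat.le_add_left k n) tendsto_id
  refine tendsto_nhds_unique ((hμ.tendsto_maskProd hr hB ξ).comp hshift) ?_
  exact (htail.const_mul _).congr fun k => (maskProd_add r B n k ξ).symm

end WeakLimit

section Torus

/-- The projection of `ℝ^d` onto the torus `ℝ^d / ℤ^d`. -/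
def toTorus (x : 𝔼 d) : UnitAddTorus (Fin d) := fun i => (x i : UnitAddCircle)

lemma continuous_toTorus : Continuous (toTorus (d := d)) :=
  continuous_pi fun i => (AddCircle.continuous_mk' 1).comp (by fun_prop)

lemma mFourier_toTorus (k : Fin d → ℤ) (x : 𝔼 d) :
    UnitAddTorus.mFourier k (toTorus x) = expFun (intVec k) x := by
  rw [UnitAddTorus.mFourier, ContinuousMap.coe_mk, expFun, inner_eq_sum]
  simp only [toTorus, fourier_coe_apply, ← Complex.exp_sum]
  push_cast
  rw [Finset.mul_sum]
  refine congrArg Complex.exp (Finset.sum_congr rfl fun i _ => ?_)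
  rw [intVec_apply, Complex.ofReal_intCast]
  ring

lemma exists_eq_add_intVec_of_toTorus_eq {x y : 𝔼 d} (h : toTorus x = toTorus y) :
    ∃ k, y = x + intVec k := by
  have hcoord : ∀ i, ∃ k : ℤ, y i = x i + k := fun i => by
    have hsub : ((y i - x i : ℝ) : UnitAddCircle) = 0 := by
      rw [AddCircle.coe_sub, sub_eq_zero]
      exact (congrFun h i).symm
    obtain ⟨n, hn⟩ := (AddCircle.coe_eq_zero_iff 1).1 hsub
    exact ⟨n, by rw [zsmul_eq_mul, mul_one] at hn; linarith⟩
  choose k hk using hcoord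
  exact ⟨k, by ext i; simp [hk]⟩

variable {μ : Measure (𝔼 d)} [IsFiniteMeasure μ] {ξ : 𝔼 d}

lemma integrable_comp_toTorus_mul_expFun (f : C(UnitAddTorus (Fin d), ℂ)) (ξ : 𝔼 d) :
    Integrable (fun x => f (toTorus x) * expFun ξ x) μ :=
  .of_bound ((f.continuous.comp continuous_toTorus).mul (continuous_expFun ξ)).aestronglyMeasurable
    ‖f‖ (.of_forall fun x => by simpa using f.norm_coe_le_norm (toTorus x))

lemma integral_comp_toTorus_mul_expFun_eq_zero
    (hξ : ∀ k, fourierTransform μ (ξ + intVec k) = 0) (f : C(UnitAddTorus (Fin d), ℂ)) :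
    ∫ x, f (toTorus x) * expFun ξ x ∂μ = 0 := by
  let T : C(UnitAddTorus (Fin d), ℂ) →L[ℂ] ℂ := LinearMap.mkContinuous
    { toFun := fun f => ∫ x, f (toTorus x) * expFun ξ x ∂μ
      map_add' := fun f g => by
        rw [← integral_add (integrable_comp_toTorus_mul_expFun f ξ)
          (integrable_comp_toTorus_mul_expFun g ξ)]
        simp [add_mul]
      map_smul' := fun c f => by simp [mul_assoc, integral_const_mul] }
    (μ.real Set.univ) fun f => by
      rw [mul_comm]
      refine norm_integral_le_of_norm_le_const (.of_forall fun x => ?_)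
      simpa using f.norm_coe_le_norm (toTorus x)
  have hker : (Submodule.span ℂ (Set.range UnitAddTorus.mFourier)).topologicalClosure ≤
      LinearMap.ker T.toLinearMap := by
    refine Submodule.topologicalClosure_minimal _ (Submodule.span_le.2 ?_) T.isClosed_ker
    rintro _ ⟨k, rfl⟩
    change ∫ x, UnitAddTorus.mFourier k (toTorus x) * expFun ξ x ∂μ = 0
    simpa only [mFourier_toTorus, fourierTransform, expFun_add_left, mul_comm] using hξ k
  rw [UnitAddTorus.span_mFourier_closure_eq_top] at hker
  exact hker (Submodule.mem_top (x := f))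

lemma integrable_comp_toTorus_mul_re_expFun_sub (f : C(UnitAddTorus (Fin d), ℝ)) (ξ x₀ : 𝔼 d) :
    Integrable (fun x => f (toTorus x) * (expFun ξ (x - x₀)).re) μ :=
  .of_bound (Continuous.aestronglyMeasurable ((f.continuous.comp continuous_toTorus).mul
    (Complex.continuous_re.comp ((continuous_expFun ξ).comp (continuous_sub_right x₀))))) ‖f‖
    (.of_forall fun x => by
      rw [norm_mul]
      exact (mul_le_of_le_one_right (norm_nonneg _) ((Complex.abs_re_le_norm _).trans
        (norm_expFun _ _).le)).trans (f.norm_coe_le_norm _))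

lemma integral_comp_toTorus_mul_re_expFun_sub_eq_zero
    (hξ : ∀ k, fourierTransform μ (ξ + intVec k) = 0) (f : C(UnitAddTorus (Fin d), ℝ))
    (x₀ : 𝔼 d) : ∫ x, f (toTorus x) * (expFun ξ (x - x₀)).re ∂μ = 0 := by
  let F : C(UnitAddTorus (Fin d), ℂ) := ⟨fun t => expFun ξ (-x₀) * f t, by fun_prop⟩
  have hF : ∫ x, F (toTorus x) * expFun ξ x ∂μ = 0 :=
    integral_comp_toTorus_mul_expFun_eq_zero hξ F
  have hre : ∀ x, (F (toTorus x) * expFun ξ x).re = f (toTorus x) * (expFun ξ (x - x₀)).re := by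
    intro x
    rw [sub_eq_add_neg, expFun_add_right, ← Complex.re_ofReal_mul]
    exact congrArg Complex.re (by simp only [F, ContinuousMap.coe_mk]; ring)
  rw [← integral_congr_ae (.of_forall hre)]
  exact (integral_re (integrable_comp_toTorus_mul_expFun F ξ)).trans (congrArg Complex.re hF)

lemma exists_continuousMap_torus_of_translate_notMem {S U : Set (𝔼 d)} (hS : IsCompact S)
    (hU : IsOpen U) {x₀ : 𝔼 d} (hx₀ : x₀ ∈ U) (htranslate : ∀ k ≠ 0, x₀ + intVec k ∉ S) :
    ∃ f : C(UnitAddTorus (Fin d), ℝ), (∀ t, 0 ≤ f t) ∧ f (toTorus x₀) = 1 ∧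
      ∀ x ∈ S \ U, f (toTorus x) = 0 := by
  have hclosed : IsClosed (toTorus '' (S \ U)) :=
    ((hS.diff hU).image continuous_toTorus).isClosed
  have hdisj : Disjoint (toTorus '' (S \ U)) {toTorus x₀} := by
    rw [Set.disjoint_singleton_right]
    rintro ⟨y, ⟨hyS, hyU⟩, hy⟩
    obtain ⟨k, rfl⟩ := exists_eq_add_intVec_of_toTorus_eq hy.symm
    rcases eq_or_ne k 0 with rfl | hk
    · exact hyU (by simpa using hx₀)
    · exact htranslate k hk hyS
  obtain ⟨f, hf0, hf1, hf⟩ := exists_continuous_zero_one_of_isClosed hclosed isClosed_singleton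
    hdisj
  exact ⟨f, fun t => (hf t).1, hf1 rfl, fun x hx => hf0 ⟨x, hx, rfl⟩⟩

lemma integral_pos_of_mem_support {X : Type*} [TopologicalSpace X] [MeasurableSpace X]
    {μ : Measure X} {g : X → ℝ} (hg : Continuous g) (hgi : Integrable g μ) (hg0 : 0 ≤ᵐ[μ] g)
    {x₀ : X} (hx₀ : x₀ ∈ μ.support) (hpos : 0 < g x₀) : 0 < ∫ x, g x ∂μ :=
  (integral_pos_iff_support_of_nonneg_ae hg0 hgi).2 <|
    (Measure.mem_support_iff_forall x₀).1 hx₀ _ (hg.isOpen_support.mem_nhds hpos.ne')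

/-- On `S ∩ U` the test function `f (toTorus x) * re e_ξ (x - x₀)` is nonnegative when `U` is the
set where the cosine is positive, and it vanishes on `S \ U`; if its integral is zero, then `x₀`
cannot be the only point of its class modulo `ℤ^d` in `S`. -/
theorem exists_translate_mem_of_fourierTransform_eq_zero {S : Set (𝔼 d)} (hS : IsCompact S)
    (hμS : ∀ᵐ x ∂μ, x ∈ S) {x₀ : 𝔼 d} (hx₀ : x₀ ∈ μ.support)
    (hξ : ∀ k, fourierTransform μ (ξ + intVec k) = 0) : ∃ k ≠ 0, x₀ + intVec k ∈ S := by
  by_contra! htranslate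
  have hcont : Continuous fun x => (expFun ξ (x - x₀)).re :=
    Complex.continuous_re.comp ((continuous_expFun ξ).comp (continuous_sub_right x₀))
  obtain ⟨f, hf_nonneg, hf_one, hf_zero⟩ := exists_continuousMap_torus_of_translate_notMem
    (U := {x | 0 < (expFun ξ (x - x₀)).re}) hS (isOpen_lt continuous_const hcont) (x₀ := x₀)
    (by simp) htranslate
  have hnonneg : ∀ᵐ x ∂μ, 0 ≤ f (toTorus x) * (expFun ξ (x - x₀)).re := by
    filter_upwards [hμS] with x hxS
    rcases le_or_gt (expFun ξ (x - x₀)).re 0 with hle | hlt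
    · rw [hf_zero x ⟨hxS, hle.not_gt⟩, zero_mul]
    · exact mul_nonneg (hf_nonneg _) hlt.le
  refine (integral_pos_of_mem_support ((f.continuous.comp continuous_toTorus).mul hcont)
    (integrable_comp_toTorus_mul_re_expFun_sub f ξ x₀) hnonneg hx₀ ?_).ne'
    (integral_comp_toTorus_mul_re_expFun_sub_eq_zero hξ f x₀)
  simp [hf_one]

end Torus

section Digits

lemma not_forall_exists_jump_of_sub_one_le {ι : Type*} [Fintype ι] {m : ι → ℤ}
    (hm : ∀ i, (Fintype.card ι : ℤ) < m i) {c : ℕ → ι → ℤ}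
    (hstep : ∀ n i, c n i - 1 ≤ c (n + 1) i) :
    ¬ ∀ n, ∃ i, c n i = 0 ∧ c (n + 1) i = m i - 1 := by
  intro hjump
  choose i hzero htop using hjump
  obtain ⟨s, t, hst, heq⟩ := Fintype.exists_ne_map_eq_of_card_lt
    (fun n : Fin (Fintype.card ι + 1) => i n) (by simp)
  wlog hlt : s < t generalizing s t
  · exact this t s hst.symm heq.symm (lt_of_le_of_ne (not_lt.1 hlt) hst.symm)
  have hdecay : ∀ j : ℕ, m (i s) - 1 - j ≤ c (s + 1 + j) (i s) := by
    intro j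
    induction j with
    | zero => simp [htop]
    | succ j ih =>
      have := hstep (s + 1 + j) (i s)
      push_cast
      rw [← add_assoc]
      linarith
  obtain ⟨j, hj⟩ := Nat.exists_eq_add_of_lt (Fin.lt_def.1 hlt)
  have hcross := hdecay j
  rw [show (s : ℕ) + 1 + j = t by omega, heq, hzero] at hcross
  have := hm (i t)
  omega

/-- The distance from the digit `b` to the only digit at which `b + x + m * k = b' + y` with
`x, y ∈ [0, 1]` and a digit `b'` allows a carry `k ≠ 0`. That digit is `m - 1` if `x = 1`, and `0`
if `x = 0`; for other values of `x` there is no such digit, and the choice of `0` is arbitrary. -/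
def digitCounter (m : ℤ) (x : ℝ) (b : ℤ) : ℤ :=
  open Classical in if x = 1 then m - 1 - b else b

variable {m b b' k : ℤ} {x y : ℝ}

lemma digitCounter_of_carry (hb : b ∈ Set.Icc 0 (m - 1)) (hb' : b' ∈ Set.Icc 0 (m - 1))
    (hx : x ∈ Set.Icc 0 1) (hy : y ∈ Set.Icc 0 1) (h : b + x + m * k = b' + y) (hk : k ≠ 0) :
    digitCounter m x b = 0 ∧ digitCounter m x b' = m - 1 := by
  have hm : 0 < m := by linarith [hb.1, hb.2]
  have hb0 : (0 : ℝ) ≤ b := by exact_mod_cast hb.1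
  have hb1 : (b : ℝ) ≤ m - 1 := by exact_mod_cast hb.2
  have hb0' : (0 : ℝ) ≤ b' := by exact_mod_cast hb'.1
  have hb1' : (b' : ℝ) ≤ m - 1 := by exact_mod_cast hb'.2
  rcases lt_or_gt_of_ne hk with hneg | hpos
  · have hmk : (m : ℝ) * k ≤ -m := by exact_mod_cast (by nlinarith : m * k ≤ -m)
    have hx1 : x = 1 := by linarith [hx.2, hy.1]
    have hbm : b = m - 1 := by exact_mod_cast (by linarith [hx.2, hy.1] : (b : ℝ) = m - 1)
    have hbz : b' = 0 := by exact_mod_cast (by linarith [hx.2, hy.1] : (b' : ℝ) = 0)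
    simp [digitCounter, hx1, hbm, hbz]
  · have hmk : (m : ℝ) ≤ m * k := by exact_mod_cast (by nlinarith : m ≤ m * k)
    have hx0 : x = 0 := by linarith [hx.1, hy.2]
    have hbz : b = 0 := by exact_mod_cast (by linarith [hx.1, hy.2] : (b : ℝ) = 0)
    have hbm : b' = m - 1 := by exact_mod_cast (by linarith [hx.1, hy.2] : (b' : ℝ) = m - 1)
    simp [digitCounter, hx0, hbm, hbz]

lemma digitCounter_sub_one_le (hb : b ∈ Set.Icc 0 (m - 1)) (hb' : b' ∈ Set.Icc 0 (m - 1))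
    (hx : x ∈ Set.Icc 0 1) (hy : y ∈ Set.Icc 0 1) (h : b + x + m * k = b' + y) :
    digitCounter m x b - 1 ≤ digitCounter m x b' := by
  rcases eq_or_ne k 0 with rfl | hk
  · rw [Int.cast_zero, mul_zero, add_zero] at h
    unfold digitCounter
    split_ifs
    · have : b' ≤ b + 1 := by exact_mod_cast (by linarith [hx.2, hy.1] : (b' : ℝ) ≤ b + 1)
      linarith
    · exact_mod_cast (by linarith [hx.1, hy.2] : (b : ℝ) - 1 ≤ b')
  · obtain ⟨hzero, htop⟩ := digitCounter_of_carry hb hb' hx hy h hk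
    linarith [hb.1, hb.2]

/-- If every choice of `b` failed, then following the translates would produce a sequence of
digits in which each step carries in some coordinate. By `digitCounter`, two carries in the same
coordinate `i` are at least `m i` steps apart, so `d` coordinates do not suffice. -/
lemma exists_translate_notMem {m : Fin d → ℤ} (hm : ∀ i, (d : ℤ) < m i)
    {B : Finset (Fin d → ℤ)} (hB : B.Nonempty) (hdig : IsDigitSet m B) {S : Set (𝔼 d)}
    (hS : S ⊆ cube d) {x : 𝔼 d} (hx : x ∈ S) :
    ∃ b ∈ B, ∀ k ≠ 0, invScale m (intVec b + x) + intVec k ∉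
      ⋃ b' ∈ B, (fun y => invScale m (intVec b' + y)) '' S := by
  by_contra! hcon
  have hsucc : ∀ b : B, ∃ b' : B, ∃ k : Fin d → ℤ, k ≠ 0 ∧ ∃ y ∈ S,
      invScale m (intVec b'.1 + y) = invScale m (intVec b.1 + x) + intVec k := fun b => by
    obtain ⟨k, hk, hmem⟩ := hcon b b.2
    obtain ⟨b', hb', y, hy, h⟩ := Set.mem_iUnion₂.1 hmem
    exact ⟨⟨b', hb'⟩, k, hk, y, hy, h⟩
  choose next k hk y hy hnext using hsucc
  have hcoord : ∀ b i, ((b.1 i : ℤ) : ℝ) + x i + m i * k b i = ((next b).1 i : ℤ) + y b i := by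
    intro b i
    have hmi : (m i : ℝ) ≠ 0 := by exact_mod_cast (by linarith [hm i] : 0 < m i).ne'
    have h := congrArg (fun z : 𝔼 d => z i) (hnext b)
    simp only [PiLp.add_apply, invScale_apply, intVec_apply] at h
    field_simp at h
    linarith
  let b : ℕ → B := fun n => next^[n] ⟨hB.choose, hB.choose_spec⟩
  have hb_succ : ∀ n, b (n + 1) = next (b n) := fun n => Function.iterate_succ_apply' _ _ _
  have hdig' : ∀ (b : B) i, b.1 i ∈ Set.Icc 0 (m i - 1) := fun b i => hdig b b.2 i
  refine not_forall_exists_jump_of_sub_one_le (m := m) (by simpa using hm)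
    (c := fun n i => digitCounter (m i) (x i) ((b n).1 i)) (fun n i => ?_) fun n => ?_
  · rw [hb_succ]
    exact digitCounter_sub_one_le (hdig' _ i) (hdig' _ i) (hS hx i) (hS (hy _) i) (hcoord _ i)
  · obtain ⟨i, hi⟩ := Function.ne_iff.1 (hk (b n))
    rw [hb_succ]
    exact ⟨i, digitCounter_of_carry (hdig' _ i) (hdig' _ i) (hS hx i) (hS (hy _) i)
      (hcoord _ i) hi⟩

end Digits

section EquiPositiveFamily

variable {m : Fin d → ℤ} {B : Finset (Fin d → ℤ)}

theorem exists_fourierTransform_prependDigit_ne_zero (hm : ∀ i, (d : ℤ) < m i) (hB : B.Nonempty)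
    (hdig : IsDigitSet m B) {ν : Measure (𝔼 d)} [IsProbabilityMeasure ν]
    (hν : ∀ᵐ x ∂ν, x ∈ cube d) (ξ : 𝔼 d) :
    ∃ k, fourierTransform (prependDigit m B ν) (ξ + intVec k) ≠ 0 := by
  by_contra! hzero
  have := isProbabilityMeasure_prependDigit (m := m) (ν := ν) hB
  have hsupp : ν.support ⊆ cube d := Measure.support_subset_of_isClosed isCompact_cube.isClosed hν
  have hcompact : IsCompact (⋃ b ∈ B, (fun x => invScale m (intVec b + x)) '' ν.support) :=
    B.isCompact_biUnion fun b _ => (isCompact_cube.of_isClosed_subset Measure.isClosed_support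
      hsupp).image (continuous_invScale_intVec_add m b)
  have hcarrier : ∀ᵐ x ∂prependDigit m B ν,
      x ∈ ⋃ b ∈ B, (fun x => invScale m (intVec b + x)) '' ν.support :=
    ae_prependDigit hcompact.measurableSet fun b hb => Filter.mem_of_superset
      Measure.support_mem_ae fun x hx => Set.mem_biUnion hb (Set.mem_image_of_mem _ hx)
  obtain ⟨x, hx⟩ := Measure.nonempty_support (IsProbabilityMeasure.ne_zero ν)
  obtain ⟨b, hb, hnotMem⟩ := exists_translate_notMem hm hB hdig hsupp hx
  obtain ⟨k, hk, hmem⟩ := exists_translate_mem_of_fourierTransform_eq_zero hcompact hcarrier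
    (mem_support_prependDigit hb hx) hzero
  exact hnotMem k hk hmem

lemma exists_pos_forall_exists_le {X ι : Type*} [TopologicalSpace X] {K : Set X}
    (hK : IsCompact K) {F : ι → X → ℝ} (hF : ∀ k, ContinuousOn (F k) K)
    (hpos : ∀ q ∈ K, ∃ k, 0 < F k q) : ∃ ε > 0, ∀ q ∈ K, ∃ k, ε ≤ F k q := by
  refine hK.induction_on (p := fun s => ∃ ε > 0, ∀ q ∈ s, ∃ k, ε ≤ F k q) ⟨1, one_pos, by simp⟩
    (fun s t hst ⟨ε, hε, h⟩ => ⟨ε, hε, fun q hq => h q (hst hq)⟩) ?_ fun q hq => ?_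
  · rintro s t ⟨ε, hε, h⟩ ⟨ε', hε', h'⟩
    refine ⟨min ε ε', lt_min hε hε', fun q hq => hq.elim (fun hq => ?_) fun hq => ?_⟩
    · exact (h q hq).imp fun _ => (min_le_left _ _).trans
    · exact (h' q hq).imp fun _ => (min_le_right _ _).trans
  · obtain ⟨k, hk⟩ := hpos q hq
    exact ⟨_, (hF k q hq).eventually_const_lt (half_lt_self hk), F k q / 2, half_pos hk,
      fun _ hq' => ⟨k, le_of_lt hq'⟩⟩

lemma continuous_mask (B : Finset (Fin d → ℤ)) : Continuous (mask B) := by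
  have hexp : ∀ b : Fin d → ℤ, Continuous fun ξ => expFun ξ (intVec b) := fun b =>
    (continuous_expFun (intVec b)).congr fun ξ => expFun_comm _ _
  unfold mask
  fun_prop

lemma continuousOn_fourierTransform_prependDigit (m : Fin d → ℤ) (B : Finset (Fin d → ℤ)) :
    ContinuousOn (fun q : ProbabilityMeasure (𝔼 d) × 𝔼 d =>
      fourierTransform (prependDigit m B q.1) q.2) (cubeMeasures d ×ˢ Set.univ) := by
  obtain ⟨K, hK⟩ := exists_lipschitzWith_fourierTransform d
  have hcont : ContinuousOn (fun q : ProbabilityMeasure (𝔼 d) × 𝔼 d =>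
      fourierTransform (q.1 : Measure (𝔼 d)) q.2) (cubeMeasures d ×ˢ Set.univ) :=
    continuousOn_prod_of_continuousOn_lipschitzOnWith' _ K (fun ν hν => (hK ν hν).lipschitzOnWith)
      fun ξ _ => (continuous_fourierTransform_measure ξ).continuousOn
  have hscale : Continuous fun q : ProbabilityMeasure (𝔼 d) × 𝔼 d => invScale m q.2 :=
    (invScale m).continuous.comp continuous_snd
  simp only [fourierTransform_prependDigit]
  exact ((continuous_mask B).comp hscale).continuousOn.mul <|
    hcont.comp (continuous_fst.prodMk hscale).continuousOn fun q hq => ⟨hq.1, Set.mem_univ _⟩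

theorem exists_le_norm_fourierTransform_prependDigit (hm : ∀ i, (d : ℤ) < m i) (hB : B.Nonempty)
    (hdig : IsDigitSet m B) :
    ∃ ε > 0, ∀ ν ∈ cubeMeasures d, ∀ x, ∃ k,
      ε ≤ ‖fourierTransform (prependDigit m B ν) (x + intVec k)‖ := by
  obtain ⟨ε, hε, hle⟩ := exists_pos_forall_exists_le
    ((isCompact_cubeMeasures (d := d)).prod isCompact_cube)
    (F := fun k q => ‖fourierTransform (prependDigit m B q.1) (q.2 + intVec k)‖)
    (fun k => ((continuousOn_fourierTransform_prependDigit m B).comp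
      (continuous_fst.prodMk (continuous_snd.add continuous_const)).continuousOn
      fun q hq => ⟨hq.1, Set.mem_univ _⟩).norm)
    fun q hq => (exists_fourierTransform_prependDigit_ne_zero hm hB hdig hq.1 q.2).imp
      fun k hk => norm_pos_iff.2 hk
  refine ⟨ε, hε, fun ν hν x => ?_⟩
  let n : Fin d → ℤ := fun i => ⌊x i⌋
  have hfract : x - intVec n ∈ cube d := fun i =>
    ⟨Int.fract_nonneg (x i), (Int.fract_lt_one (x i)).le⟩
  obtain ⟨k, hk⟩ := hle (ν, x - intVec n) ⟨hν, hfract⟩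
  refine ⟨k - n, ?_⟩
  rwa [intVec_sub, add_sub_left_comm, add_comm]

lemma isLatticePositive_of_lipschitzWith {φ : 𝔼 d → ℂ} {K : NNReal} (hφ : LipschitzWith K φ)
    {ε : ℝ} (h0 : ε ≤ ‖φ 0‖) (h : ∀ x, ∃ k, ε ≤ ‖φ (x + intVec k)‖) :
    IsLatticePositive (ε / 2) (ε / 2 / (K + 1)) φ := by
  have hnear : ∀ x y, ε ≤ ‖φ x‖ → ‖y‖ < ε / 2 / (K + 1) → ε / 2 ≤ ‖φ (x + y)‖ := by
    intro x y hx hy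
    have hlip : ‖φ x - φ (x + y)‖ ≤ K * ‖y‖ := by
      simpa [dist_eq_norm] using hφ.dist_le_mul x (x + y)
    have hy' := (lt_div_iff₀ (by positivity)).1 hy
    linarith [norm_sub_norm_le (φ x) (φ (x + y)), norm_nonneg y]
  intro x
  rcases eq_or_ne x 0 with rfl | hx
  · exact ⟨0, fun _ => rfl, fun y => hnear _ y (by simpa using h0)⟩
  · obtain ⟨k, hk⟩ := h x
    exact ⟨k, fun hx0 => absurd hx0 hx, fun y => hnear _ y hk⟩

theorem exists_isLatticePositive_prependDigit (hm : ∀ i, (d : ℤ) < m i) (hB : B.Nonempty)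
    (hdig : IsDigitSet m B) :
    ∃ ε > 0, ∃ δ > 0, ∀ ν ∈ cubeMeasures d,
      IsLatticePositive ε δ (fourierTransform (prependDigit m B ν)) := by
  obtain ⟨K, hK⟩ := exists_lipschitzWith_fourierTransform d
  obtain ⟨ε, hε, hle⟩ := exists_le_norm_fourierTransform_prependDigit hm hB hdig
  refine ⟨ε / 2, by positivity, ε / 2 / (K + 1), by positivity, fun ν hν => ?_⟩
  have hprob := isProbabilityMeasure_prependDigit (m := m) (ν := (ν : Measure (𝔼 d))) hB
  refine isLatticePositive_of_lipschitzWith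
    (hK ⟨prependDigit m B ν, hprob⟩ (hdig.ae_prependDigit_mem_cube hν)) ?_ (hle ν hν)
  obtain ⟨k, hk⟩ := hle ν hν 0
  rw [ProbabilityMeasure.coe_mk, fourierTransform_zero, norm_one]
  exact hk.trans (norm_fourierTransform_le_one _)

end EquiPositiveFamily

section Spectrality

variable {r : ℕ → Fin d → ℤ} {B : ℕ → Finset (Fin d → ℤ)}

lemma IsInfiniteConvolution.fourierTransform_eq_prependDigit (hr : ∀ n i, r n i ≠ 0)
    (hB : ∀ n, (B n).Nonempty) {μ ν : Measure (𝔼 d)}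
    (hμ : IsInfiniteConvolution (fun j => Matrix.diagonal (r j)) B μ)
    (hν : IsInfiniteConvolution (fun j => Matrix.diagonal (r (1 + j))) (fun j => B (1 + j)) ν) :
    fourierTransform μ = fourierTransform (prependDigit (r 0) (B 0) ν) := by
  have := hν.1
  ext ξ
  rw [hμ.fourierTransform_eq_maskProd_mul hr hB hν, fourierTransform_prependDigit]
  simp [maskProd, diagProd]

theorem exists_isSpectrum_of_frequently_eq (hr : ∀ n i, 2 ≤ r n i) (hB : ∀ n, (B n).Nonempty)
    (hdig : ∀ n, IsDigitSet (r n) (B n))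
    (hadm : ∀ n, IsAdmissiblePair (Matrix.diagonal (r n)) (B n))
    {r₀ : Fin d → ℤ} {B₀ : Finset (Fin d → ℤ)} (hr₀ : ∀ i, (d : ℤ) < r₀ i)
    (hfreq : ∃ᶠ n in atTop, r n = r₀ ∧ B n = B₀) {μ : Measure (𝔼 d)}
    (hμ : IsInfiniteConvolution (fun n => Matrix.diagonal (r n)) B μ) :
    ∃ Λ ⊆ intLattice d, IsSpectrum μ Λ := by
  have hr0 : ∀ n i, r n i ≠ 0 := fun n i => by have := hr n i; lia
  choose ν hν hconv using fun n => exists_isInfiniteConvolution (r := fun j => r (n + j))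
    (B := fun j => B (n + j)) (fun _ => hr _) (fun _ => hB _) (fun _ => hdig _)
  have hμν : ∀ n ξ, fourierTransform μ ξ =
      maskProd r B n ξ * fourierTransform (ν n : Measure (𝔼 d)) (invScale (diagProd r n) ξ) :=
    fun n => hμ.fourierTransform_eq_maskProd_mul hr0 hB (hconv n)
  have hν_zero : fourierTransform (ν 0 : Measure (𝔼 d)) = fourierTransform μ :=
    funext fun ξ => by simp [hμν 0, maskProd]
  have hν_succ : ∀ n, fourierTransform (ν n : Measure (𝔼 d)) =
      fourierTransform (prependDigit (r n) (B n) (ν (n + 1))) := fun n =>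
    (hconv n).fourierTransform_eq_prependDigit (fun _ => hr0 _) (fun _ => hB _)
      (by simpa only [add_assoc] using hconv (n + 1))
  obtain ⟨n₀, rfl, rfl⟩ := hfreq.exists
  obtain ⟨ε, hε, δ, hδ, hpos⟩ :=
    exists_isLatticePositive_prependDigit hr₀ (hB n₀) (hdig n₀)
  obtain ⟨Λ, hΛ⟩ := exists_hasSum_norm_sq
    (φ := fun n => fourierTransform (ν n : Measure (𝔼 d))) hr hB
    (fun n => (hadm n).exists_isTile (hr0 n) (hB n)) (fun n => norm_fourierTransform_le_one)
    (by simpa only [hν_zero] using hμν)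
    (by simpa only [hν_zero] using hμ.tendsto_maskProd hr0 hB) hε hδ
    (hfreq.mono fun n hn => by
      rw [hν_succ, hn.1, hn.2]
      exact hpos _ (hν _))
  simp only [hν_zero] at hΛ
  have := hμ.1
  refine ⟨intVec '' Λ, Set.image_subset_range _ _,
    isSpectrum_of_hasSum (Λ.to_countable.image _) fun ξ => ?_⟩
  exact ((Equiv.Set.image _ Λ intVec_injective).hasSum_iff
    (f := fun a : intVec '' Λ => ‖fourierTransform μ (ξ + a)‖ ^ 2)).1 (hΛ ξ)

end Spectrality

end InfConv

end

theorem theorem1p5 (d : ℕ)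
    (R : ℕ → Matrix (Fin d) (Fin d) ℤ) (B : ℕ → Finset (Fin d → ℤ))
    (hD : ∀ n, (R n, B n) ∈ InfConv.diagonalPairs d)
    (hadm : ∀ n, InfConv.IsAdmissiblePair (R n) (B n))
    (hinf : ∃ (R₀ : Matrix (Fin d) (Fin d) ℤ) (B₀ : Finset (Fin d → ℤ)),
      InfConv.IsAdmissiblePair R₀ B₀ ∧
      {n : ℕ | R n = R₀ ∧ B n = B₀}.Infinite ∧
      ∀ i, (d : ℤ) + 1 ≤ R₀ i i) :
    (∃ μ : Measure (EuclideanSpace ℝ (Fin d)), InfConv.IsInfiniteConvolution R B μ) ∧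
      ∀ μ : Measure (EuclideanSpace ℝ (Fin d)), InfConv.IsInfiniteConvolution R B μ →
        ∃ Λ : Set (EuclideanSpace ℝ (Fin d)),
          Λ ⊆ InfConv.intLattice d ∧ InfConv.IsSpectrum μ Λ := by
  obtain ⟨R₀, B₀, -, hinf, hR₀⟩ := hinf
  obtain ⟨r, rfl⟩ : ∃ r : ℕ → Fin d → ℤ, R = fun n => Matrix.diagonal (r n) :=
    ⟨fun n => (R n).diag,
      funext fun n => ((Matrix.isDiag_iff_diagonal_diag _).1 (hD n).1).symm⟩
  have hr : ∀ n i, 2 ≤ r n i := fun n i => by simpa using (hD n).2.1 i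
  have hB : ∀ n, (B n).Nonempty := fun n => (hD n).2.2.1
  have hdig : ∀ n, InfConv.IsDigitSet (r n) (B n) := fun n b hb i => by
    simpa using (hD n).2.2.2 b hb i
  have hfreq : ∃ᶠ n in atTop, r n = R₀.diag ∧ B n = B₀ :=
    (Nat.frequently_atTop_iff_infinite.2 hinf).mono fun n hn =>
      ⟨by rw [← hn.1, Matrix.diag_diagonal], hn.2⟩
  obtain ⟨μ, -, hμ⟩ := InfConv.exists_isInfiniteConvolution hr hB hdig
  exact ⟨⟨μ, hμ⟩, fun _ => InfConv.exists_isSpectrum_of_frequently_eq hr hB hdig hadm hR₀ hfreq⟩
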